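/- Let $n \ge 5$. A (deterministic) mechanism for 2-Facility Location on the real line maps every instance $\vec{x} = (x_1, \ldots, x_n) \in \mathbb{R}^n$ of agent locations to a pair $F(\vec{x}) = (F_1(\vec{x}), F_2(\vec{x}))$ of facility locations with $F_1(\vec{x}) \le F_2(\vec{x})$; we write $a \in F(\vec{x})$ if $a = F_1(\vec{x})$ or $a = F_2(\vec{x})$. The cost of an agent at $a$ for facilities at $y = (y_1, y_2)$ is $\mathrm{cost}(a, y) = \min\{|a - y_1|, |a - y_2|\}$, and the social cost of $y$ for $\vec{x}$ is $\sum_{i=1}^n \mathrm{cost}(x_i, y)$. Suppose that $F$ is strategyproof, i.e. $\mathrm{cost}(x_i, F(\vec{x})) \le \mathrm{cost}(x_i, F(\vec{x}'))$ for all instances $\vec{x}$, all agents $i$, and all $\vec{x}'$ obtained from $\vec{x}$ by changing only the $i$-th coordinate, and that $F$ has a bounded approximation ratio, i.e. there is a constant $\rho \ge 1$ such that for every instance $\vec{x}$ the social cost of $F(\vec{x})$ is at most $\rho$ times the minimum social cost for $\vec{x}$ over all $y \in \mathbb{R}^2$. Then either 1. $F(\vec{x}) = (\min \vec{x}, \max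 \vec{x})$ for all instances $\vec{x}$ in which not all agents have the same location, and $c \in F(c, \ldots, c)$ for all $c \in \mathbb{R}$, or 2. there exists a unique agent $j$ (the dictator) such that $x_j \in F(\vec{x})$ for all instances $\vec{x}$. -/

import Mathlib

namespace FacilityLocation

/-- The smallest coordinate `min x` of a (nonempty, finite) location profile. -/
noncomputable def minLoc {n : ℕ} (x : Fin n → ℝ) : ℝ := ⨅ i, x i

/-- The largest coordinate `max x` of a (nonempty, finite) location profile. -/
noncomputable def maxLoc {n : ℕ} (x : Fin n → ℝ) : ℝ := ⨆ i, x i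

/-- The cost of an agent at `a` for facilities at `y.1` and `y.2`: the distance to the nearest one. -/
def agentCost (a : ℝ) (y : ℝ × ℝ) : ℝ := min |a - y.1| |a - y.2|

/-- The social cost of the instance `x` for facilities at `y.1` and `y.2`. -/
def socialCost {n : ℕ} (x : Fin n → ℝ) (y : ℝ × ℝ) : ℝ := ∑ i, agentCost (x i) y

/-- The optimal cost of the instance `x`, over all placements of two facilities. -/
noncomputable def optCost {n : ℕ} (x : Fin n → ℝ) : ℝ := ⨅ y : ℝ × ℝ, socialCost x y

/-- A deterministic mechanism for 2-Facility Location on the line with `n` agents: it maps every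
instance to the locations of two facilities, listed in nondecreasing order. -/
structure Mechanism (n : ℕ) where
  /-- The facility locations chosen for an instance. -/
  place : (Fin n → ℝ) → ℝ × ℝ
  /-- The leftmost facility is listed first. -/
  ordered : ∀ x, (place x).1 ≤ (place x).2

/-- `a ∈ F(x)`: the mechanism places a facility at `a` for the instance `x`. -/
def Mechanism.HasFacilityAt {n : ℕ} (F : Mechanism n) (x : Fin n → ℝ) (a : ℝ) : Prop :=
  (F.place x).1 = a ∨ (F.place x).2 = a

/-- No agent can decrease her cost by misreporting her location. -/
def Mechanism.Strategyproof {n : ℕ} (F : Mechanism n) : Prop :=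
  ∀ (x : Fin n → ℝ) (i : Fin n) (y : ℝ),
    agentCost (x i) (F.place x) ≤ agentCost (x i) (F.place (Function.update x i y))

/-- The cost of the outcome is at most `ρ` times the optimal cost, for every instance. -/
def Mechanism.HasApproxRatio {n : ℕ} (F : Mechanism n) (ρ : ℝ) : Prop :=
  ∀ x : Fin n → ℝ, socialCost x (F.place x) ≤ ρ * optCost x

/-- Bounded approximation ratio: for the given number of agents some finite `ρ ≥ 1` works for all
instances. -/
def Mechanism.BoundedApprox {n : ℕ} (F : Mechanism n) : Prop :=
  ∃ ρ : ℝ, 1 ≤ ρ ∧ F.HasApproxRatio ρ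

/-- A nice mechanism: (deterministic,) strategyproof, with a bounded approximation ratio. -/
def Mechanism.Nice {n : ℕ} (F : Mechanism n) : Prop :=
  F.Strategyproof ∧ F.BoundedApprox

/-- The facilities are always placed at the two extremes of the instance. When all agents share one
location `c`, both extremes are `c`, and only a facility at `c` is required. -/
def Mechanism.AlwaysAtExtremes {n : ℕ} (F : Mechanism n) : Prop :=
  (∀ x : Fin n → ℝ, (∃ i k, x i ≠ x k) → F.place x = (minLoc x, maxLoc x)) ∧
    ∀ c : ℝ, F.HasFacilityAt (fun _ => c) c

/-- Agent `j` is a dictator: a facility is placed at her location for every instance. -/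
def Mechanism.IsDictator {n : ℕ} (F : Mechanism n) (j : Fin n) : Prop :=
  ∀ x : Fin n → ℝ, F.HasFacilityAt x (x j)

end FacilityLocation

/-!
Fix the reports of all agents but one (or one group of agents sharing a location, which by partial
group strategyproofness behaves like one agent, `NiceN.group_sp`). Strategyproofness says that the
distance of that agent to the nearest facility is her distance to a closed set of *available*
locations, those which get a facility when she reports them. Everything is deduced from the gaps of
such sets: inside a gap, the end nearer to the agent is the site of a facility (`SP1.exists_gap`).

*Three groups.* For groups at `a < b < c`, consider the locations in `[a, c]` available to the middle
group. If the last two groups are close to each other, one facility serves the first group and the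
other one is located between the last two like a strategyproof single facility. So, for given `a`,
the middle group wins against a close competitor on her right exactly at the locations of some upper
set (`WinsRight`, `Nice3.winsRight_mono`), and dually for given `c`; together, the two sets determine
the available locations (`Nice3.on_of_winsRight`, `Nice3.winsRight_or`). The last two groups cannot
both win on the right (`Nice3.not_winsRight_swap23`), and this rules out gaps ending strictly between
`a` and `c` (`Nice3.on_of_on_left`). Hence the middle group gets a facility always, or never; in the
latter case the facilities are at `a` and `c` (`Nice3.middleWins_of_on`,
`Nice3.on_left_of_not_middleWins`).

*Winning groups.* Write `Win f A B` if `B` wins when it is between `A` and the group `C` of all other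
agents. A winning middle group may be enlarged (`NiceN.win_merge_left`); if `X ∪ Y` wins between `A`
and `C`, then `Y` wins between `A ∪ X` and `C`, or `X` wins between `A` and `Y ∪ C`
(`NiceN.win_split`); and two groups exchanging places do not both win (`NiceN.not_win_swap_left`).
So if any group wins, then so does a single agent `j` (`NiceN.exists_win_singleton`), and moving the
other agents from one side to the other shows that `j` wins for all partitions of them
(`NiceN.win_singleton`).

*All instances.* Agents who move to the site of a facility leave it in place (`NiceN.on_of_move`).
If no group ever wins, a facility strictly between two agents would therefore persist when all other
agents move to it, a contradiction (`NiceN.not_on_between`); it follows that the facilities are at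
the extremes. If `j` always wins in the middle but gets no facility in some instance, she is in a gap
of her available locations. When she approaches an end of that gap and all but one of the others move
to that end, both facilities are near it, and the remaining agent is too far from them
(`NiceN.lt_of_not_on`). So `j` is a dictator.
-/

namespace FacilityLocation

/-! ### Outcomes, and strategyproofness of a single agent -/

/-- One of the two facilities of the outcome `y` is located at `t`. -/
def On (y : ℝ × ℝ) (t : ℝ) : Prop := y.1 = t ∨ y.2 = t

lemma On.agentCost_le {y : ℝ × ℝ} {t : ℝ} (h : On y t) (a : ℝ) : agentCost a y ≤ |a - t| := by
  rcases h with rfl | rfl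
  · exact min_le_left _ _
  · exact min_le_right _ _

lemma exists_nearest (a : ℝ) (y : ℝ × ℝ) : ∃ t, On y t ∧ agentCost a y = |a - t| := by
  rcases min_choice |a - y.1| |a - y.2| with h | h
  · exact ⟨y.1, Or.inl rfl, h⟩
  · exact ⟨y.2, Or.inr rfl, h⟩

lemma agentCost_nonneg (a : ℝ) (y : ℝ × ℝ) : 0 ≤ agentCost a y :=
  le_min (abs_nonneg _) (abs_nonneg _)

lemma on_of_agentCost_le_zero {a : ℝ} {y : ℝ × ℝ} (h : agentCost a y ≤ 0) : On y a := by
  obtain ⟨t, ht, hc⟩ := exists_nearest a y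
  have : |a - t| = 0 := le_antisymm (hc ▸ h) (abs_nonneg _)
  rwa [sub_eq_zero.1 (abs_eq_zero.1 this)]

lemma agentCost_eq_zero {a : ℝ} {y : ℝ × ℝ} (h : On y a) : agentCost a y = 0 :=
  le_antisymm (by simpa using h.agentCost_le a) (agentCost_nonneg _ _)

/-- There are only two facilities. -/
lemma On.eq_or {y : ℝ × ℝ} {r s t : ℝ} (hr : On y r) (hs : On y s) (ht : On y t) (hst : s ≠ t) :
    r = s ∨ r = t := by
  unfold On at *
  grind

/-- The mirror image of an outcome. -/
def negOutcome (y : ℝ × ℝ) : ℝ × ℝ := (-y.1, -y.2)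

lemma on_negOutcome {y : ℝ × ℝ} {t : ℝ} : On (negOutcome y) t ↔ On y (-t) := by
  unfold On negOutcome
  simp only [neg_eq_iff_eq_neg]

lemma agentCost_negOutcome (t : ℝ) (y : ℝ × ℝ) : agentCost t (negOutcome y) = agentCost (-t) y := by
  unfold agentCost negOutcome
  rw [← abs_neg (t - _), ← abs_neg (t - _)]
  congr 2 <;> ring

/-- Strategyproofness seen by one agent (or one group of agents sharing a location), the reports of
all others being fixed: `g` maps the report of that agent to the outcome. -/
def SP1 (g : ℝ → ℝ × ℝ) : Prop := ∀ x z, agentCost x (g x) ≤ agentCost x (g z)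

namespace SP1

variable {g : ℝ → ℝ × ℝ}

lemma near (h : SP1 g) {z t : ℝ} (ht : On (g z) t) (x : ℝ) :
    ∃ s, On (g x) s ∧ |x - s| ≤ |x - t| := by
  obtain ⟨s, hs, hc⟩ := exists_nearest x (g x)
  exact ⟨s, hs, hc ▸ (h x z).trans (ht.agentCost_le x)⟩

/-- An agent who moves to a facility location keeps a facility there. -/
lemma fix (h : SP1 g) {z t : ℝ} (ht : On (g z) t) : On (g t) t :=
  on_of_agentCost_le_zero ((h t z).trans (agentCost_eq_zero ht).le)

/-- An agent who moves towards her nearest facility keeps it. -/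
lemma toward (h : SP1 g) {z w t : ℝ} (ht : On (g z) t) (hc : ∀ s, On (g z) s → |z - t| ≤ |z - s|)
    (hw : |z - w| + |w - t| ≤ |z - t|) : On (g w) t := by
  obtain ⟨s, hs, hst⟩ := h.near ht w
  obtain ⟨r, hr, hrc⟩ := h.near hs z
  have h1 := hc r hr
  by_cases hwz : w = z
  · rwa [hwz]
  have : 0 < |z - w| := abs_pos.2 (sub_ne_zero.2 (Ne.symm hwz))
  have : s = t := by grind
  rwa [← this]

lemma isClosed (h : SP1 g) : IsClosed {t | On (g t) t} := by
  rw [← isOpen_compl_iff, Metric.isOpen_iff]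
  intro x hx
  refine ⟨agentCost x (g x), ?_, ?_⟩
  · rcases (agentCost_nonneg x (g x)).lt_or_eq with h0 | h0
    · exact h0
    · exact absurd (on_of_agentCost_le_zero h0.ge) hx
  · intro s hs hon
    have h1 := (h x s).trans (On.agentCost_le hon x)
    rw [Metric.mem_ball, Real.dist_eq, abs_sub_comm] at hs
    linarith

/-- If no facility is at the agent's location `a`, but some report `r₀ > a` gets a facility at
`r₀`, then the nearest available location `r` to the right of `a` ends a gap. -/
lemma exists_right (h : SP1 g) {a r₀ : ℝ} (ha : ¬ On (g a) a) (hr : On (g r₀) r₀) (har : a < r₀) :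
    ∃ r, a < r ∧ r ≤ r₀ ∧ On (g r) r ∧ (∀ s, a ≤ s → s < r → ¬ On (g s) s) ∧
      ∀ t, t < r → r - t < t - a → On (g t) r := by
  have hcl : IsClosed ({t | On (g t) t} ∩ Set.Ici a) := h.isClosed.inter isClosed_Ici
  have hbd : BddBelow ({t | On (g t) t} ∩ Set.Ici a) := ⟨a, fun _ ht => ht.2⟩
  have hmem := hcl.csInf_mem ⟨r₀, hr, har.le⟩ hbd
  set r := sInf ({t | On (g t) t} ∩ Set.Ici a)
  have hlow : ∀ s, a ≤ s → s < r → ¬ On (g s) s :=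
    fun s hs hsr hon => absurd (csInf_le hbd ⟨hon, hs⟩) (not_le.2 hsr)
  have har' : a < r := lt_of_le_of_ne hmem.2 (fun he => ha (by rw [he]; exact hmem.1))
  refine ⟨r, har', csInf_le hbd ⟨hr, har.le⟩, hmem.1, hlow, fun t htr hta => ?_⟩
  obtain ⟨s, hs, hst⟩ := h.near hmem.1 t
  have hsI := h.fix hs
  have h1 : ¬ (a ≤ s ∧ s < r) := fun hh => hlow s hh.1 hh.2 hsI
  have : s = r := by grind
  rwa [← this]

/-- The gap around a location without a facility, between two available locations. -/
lemma exists_gap (h : SP1 g) {l₀ b r₀ : ℝ} (hl : On (g l₀) l₀) (hb : ¬ On (g b) b)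
    (hr : On (g r₀) r₀) (hlb : l₀ < b) (hbr : b < r₀) :
    ∃ l r, l₀ ≤ l ∧ l < b ∧ b < r ∧ r ≤ r₀ ∧ On (g l) l ∧ On (g r) r ∧
      (∀ s, l < s → s < r → ¬ On (g s) s) ∧
      (∀ t, l < t → t < r → t - l < r - t → On (g t) l) ∧
      (∀ t, l < t → t < r → r - t < t - l → On (g t) r) := by
  obtain ⟨r, hbr', hrr, hrI, hrlow, -⟩ := h.exists_right hb hr hbr
  have h' : SP1 (fun x => negOutcome (g (-x))) := fun x z => by
    simp only [agentCost_negOutcome]; exact h _ _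
  obtain ⟨l, hbl, hll, hlI, hllow, -⟩ := h'.exists_right (a := -b) (r₀ := -l₀)
    (by simpa [on_negOutcome] using hb) (by simpa [on_negOutcome] using hl) (by linarith)
  have hno : ∀ s, -l < s → s < r → ¬ On (g s) s := by
    intro s h1 h2 hon
    rcases le_total b s with hs | hs
    · exact hrlow s hs h2 hon
    · exact hllow (-s) (by linarith) (by linarith) (by simpa [on_negOutcome] using hon)
  have hlI' : On (g (-l)) (-l) := by simpa [on_negOutcome] using hlI
  refine ⟨-l, r, by linarith, by linarith, hbr', hrr, hlI', hrI, hno,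
    fun t h1 h2 h3 => ?_, fun t h1 h2 h3 => ?_⟩
  · obtain ⟨s, hs, hst⟩ := h.near hlI' t
    have h4 : ¬ (-l < s ∧ s < r) := fun hh => hno s hh.1 hh.2 (h.fix hs)
    have : s = -l := by grind
    rwa [← this]
  · obtain ⟨s, hs, hst⟩ := h.near hrI t
    have h4 : ¬ (-l < s ∧ s < r) := fun hh => hno s hh.1 hh.2 (h.fix hs)
    have : s = r := by grind
    rwa [← this]

end SP1

/-- A property that propagates to the right by steps of a fixed length reaches every point. -/
lemma step_induction {S : ℝ → Prop} {t B δ : ℝ} (hδ : 0 < δ)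
    (h : ∀ s b, t ≤ s → s ≤ b → b ≤ s + δ → b ≤ B → S s → S b) (ht : S t) (htB : t ≤ B) : S B := by
  have key : ∀ n : ℕ, ∀ b, t ≤ b → b ≤ B → b ≤ t + n * δ → S b := by
    intro n
    induction n with
    | zero =>
      intro b h1 _ h3
      have : b = t := le_antisymm (by simpa using h3) h1
      rwa [this]
    | succ n ih =>
      intro b h1 h2 h3
      push_cast at h3
      rcases le_total b (t + δ) with h4 | h4
      · exact h t b le_rfl h1 h4 h2 ht
      · exact h (b - δ) b (by linarith) (by linarith) (by linarith) h2
          (ih _ (by linarith) (by linarith) (by linarith))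
  obtain ⟨n, hn⟩ := exists_nat_ge ((B - t) / δ)
  refine key n B htB le_rfl ?_
  rw [div_le_iff₀ hδ] at hn
  linarith

/-! ### Mechanisms for three agents -/

/-- A strategyproof mechanism for three agents with bounded individual cost, in curried form. It
arises from a mechanism for more agents by partitioning them into three groups, all members of a
group reporting the same location. -/
structure Nice3 (f : ℝ → ℝ → ℝ → ℝ × ℝ) (ρ : ℝ) : Prop where
  one_le : 1 ≤ ρ
  sp1 : ∀ b c, SP1 (fun a => f a b c)
  sp2 : ∀ a c, SP1 (fun b => f a b c)
  sp3 : ∀ a b, SP1 (fun c => f a b c)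
  bound : ∀ a b c t, t = a ∨ t = b ∨ t = c → ∀ z, agentCost t (f a b c) ≤
    ρ * (agentCost a z + agentCost b z + agentCost c z)

/-- The mechanism with the second and the third agent exchanged. -/
def swap23 (f : ℝ → ℝ → ℝ → ℝ × ℝ) : ℝ → ℝ → ℝ → ℝ × ℝ := fun a b c => f a c b

/-- The mirror image of a mechanism, with the agents listed in reverse order, so that increasing
triples correspond to increasing triples. -/
def refl3 (f : ℝ → ℝ → ℝ → ℝ × ℝ) : ℝ → ℝ → ℝ → ℝ × ℝ :=
  fun a b c => negOutcome (f (-c) (-b) (-a))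

/-- With the first agent at `a`, the second agent at `t` gets a facility as soon as the third agent
is to the right of `t` and close enough. -/
def WinsRight (f : ℝ → ℝ → ℝ → ℝ × ℝ) (a t : ℝ) : Prop :=
  a < t ∧ ∃ c₀, t < c₀ ∧ ∀ c, t < c → c ≤ c₀ → On (f a t c) t

namespace Nice3

variable {f : ℝ → ℝ → ℝ → ℝ × ℝ} {ρ : ℝ}

lemma swap23 (h : Nice3 f ρ) : Nice3 (swap23 f) ρ where
  one_le := h.one_le
  sp1 b c := h.sp1 c b
  sp2 a c := h.sp3 a c
  sp3 a b := h.sp2 a b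
  bound a b c t ht z := by
    have := h.bound a c b t (by tauto) z
    simp only [FacilityLocation.swap23]
    linarith

lemma refl3 (h : Nice3 f ρ) : Nice3 (refl3 f) ρ where
  one_le := h.one_le
  sp1 b c x z := by
    simp only [FacilityLocation.refl3, agentCost_negOutcome]; exact h.sp3 _ _ _ _
  sp2 b c x z := by
    simp only [FacilityLocation.refl3, agentCost_negOutcome]; exact h.sp2 _ _ _ _
  sp3 b c x z := by
    simp only [FacilityLocation.refl3, agentCost_negOutcome]; exact h.sp1 _ _ _ _
  bound a b c t ht z := by
    have := h.bound (-c) (-b) (-a) (-t) (by simp only [neg_inj]; tauto) (negOutcome z)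
    simp only [FacilityLocation.refl3, agentCost_negOutcome, neg_neg] at this ⊢
    linarith

lemma cost_le_right (h : Nice3 f ρ) (a b c : ℝ) {t : ℝ} (ht : t = a ∨ t = b ∨ t = c) :
    agentCost t (f a b c) ≤ ρ * |b - c| := by
  have h1 := h.bound a b c t ht (a, c)
  have h2 : agentCost a (a, c) = 0 := agentCost_eq_zero (Or.inl rfl)
  have h3 : agentCost c (a, c) = 0 := agentCost_eq_zero (Or.inr rfl)
  have h4 : agentCost b (a, c) ≤ |b - c| := On.agentCost_le (Or.inr rfl) b
  have := h.one_le
  nlinarith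

lemma cost_le_left (h : Nice3 f ρ) (a b c : ℝ) {t : ℝ} (ht : t = a ∨ t = b ∨ t = c) :
    agentCost t (f a b c) ≤ ρ * |a - b| := by
  have h1 := h.bound a b c t ht (b, c)
  have h2 : agentCost b (b, c) = 0 := agentCost_eq_zero (Or.inl rfl)
  have h3 : agentCost c (b, c) = 0 := agentCost_eq_zero (Or.inr rfl)
  have h4 : agentCost a (b, c) ≤ |a - b| := On.agentCost_le (Or.inl rfl) a
  have := h.one_le
  nlinarith

lemma on_of_eq_right (h : Nice3 f ρ) (a c : ℝ) {t : ℝ} (ht : t = a ∨ t = c) :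
    On (f a c c) t :=
  on_of_agentCost_le_zero (by simpa using h.cost_le_right a c c (t := t) (by tauto))

lemma on_of_eq_left (h : Nice3 f ρ) (a c : ℝ) {t : ℝ} (ht : t = a ∨ t = c) :
    On (f a a c) t :=
  on_of_agentCost_le_zero (by simpa using h.cost_le_left a a c (t := t) (by tauto))

/-- If the middle agent gets no facility, there is one on each side of her. -/
lemma exists_split (h : Nice3 f ρ) {a b c : ℝ} (hab : a < b) (hbc : b < c)
    (hb : ¬ On (f a b c) b) :
    ∃ u v, On (f a b c) u ∧ On (f a b c) v ∧ u < b ∧ b < v := by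
  obtain ⟨u, hu, hu'⟩ := (h.sp1 b c).near (h.on_of_eq_left b c (t := b) (by tauto)) a
  obtain ⟨v, hv, hv'⟩ := (h.sp3 a b).near (h.on_of_eq_right a b (t := b) (by tauto)) c
  have h1 : u ≠ b := fun he => hb (he ▸ hu)
  have h2 : v ≠ b := fun he => hb (he ▸ hv)
  exact ⟨u, v, hu, hv, by grind, by grind⟩

/-- If the second and the third agent are close to each other and far to the right of the first
agent, then one facility serves the first agent, and the other one is between the other two. -/
lemma exists_window (h : Nice3 f ρ) {a b c : ℝ} (hbc : b ≤ c) (hw : (ρ + 1) * (c - b) < b - a) :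
    ∃ u v, On (f a b c) u ∧ On (f a b c) v ∧ u < b - (c - b) ∧ |a - u| ≤ ρ * (c - b) ∧
      b ≤ v ∧ v ≤ c := by
  obtain ⟨u, hu, hu'⟩ := exists_nearest a (f a b c)
  have h1 := h.cost_le_right a b c (t := a) (by tauto)
  rw [hu', abs_sub_comm b c, abs_of_nonneg (sub_nonneg.2 hbc)] at h1
  obtain ⟨s, hs, hs'⟩ := (h.sp2 a c).near (h.on_of_eq_right a c (t := c) (by tauto)) b
  obtain ⟨v, hv, hv'⟩ := (h.sp3 a b).near (h.on_of_eq_right a b (t := b) (by tauto)) c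
  have hu1 : u < b - (c - b) := by
    have := abs_le.1 h1
    linarith
  have hus : u ≠ s := by grind
  have hvs : v = s := by
    rcases hv.eq_or hu hs hus with hv1 | hv1
    · grind
    · exact hv1
  subst hvs
  exact ⟨u, v, hu, hv, hu1, h1, by grind, by grind⟩

/-- In the situation of `exists_window`, the two close agents cannot both be sites of facilities. -/
lemma window_unique (h : Nice3 f ρ) {a b c s t : ℝ} (hbc : b ≤ c)
    (hw : (ρ + 1) * (c - b) < b - a) (hs : On (f a b c) s) (ht : On (f a b c) t)
    (hbs : b ≤ s) (hbt : b ≤ t) : s = t := by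
  obtain ⟨u, v, hu, -, hu1, -⟩ := h.exists_window hbc hw
  by_contra hst
  rcases hu.eq_or hs ht hst with hh | hh <;> linarith

lemma winsRight_of_on (h : Nice3 f ρ) {a t c : ℝ} (htc : t < c)
    (hw : (ρ + 1) * (c - t) < t - a) (ht : On (f a t c) t) : WinsRight f a t := by
  have hρ := h.one_le
  refine ⟨by nlinarith, c, htc, fun c' h1 h2 => ?_⟩
  refine (h.sp3 a t).toward (z := c) (w := c') ht (fun s hs => ?_) (by grind)
  obtain ⟨u, v, hu, hv, hu1, -⟩ := h.exists_window htc.le hw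
  by_cases hst : s = t
  · rw [hst]
  · rcases hu.eq_or hs ht hst with hh | hh
    · grind
    · grind

lemma on_of_winsRight_of_window (h : Nice3 f ρ) {a t c : ℝ} (htc : t < c)
    (hw : (ρ + 1) * (c - t) < t - a) (ht : WinsRight f a t) : On (f a t c) t := by
  have hρ := h.one_le
  by_contra hno
  obtain ⟨hat, c₀, htc₀, hon⟩ := ht
  obtain ⟨u, v, hu, hv, hu1, -, htv, hvc⟩ := h.exists_window htc.le hw
  have htv' : t < v := lt_of_le_of_ne htv (fun he => hno (he ▸ hv))
  obtain ⟨c', hc1, hc2⟩ := exists_between (lt_min htc₀ htv')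
  have hc3 := hc2.trans_le (min_le_left _ _)
  have hc4 := hc2.trans_le (min_le_right _ _)
  have hw' : ∀ x, t ≤ x → x ≤ c → (ρ + 1) * (x - t) < t - a := fun x h1 h2 => by nlinarith
  have hno' : ¬ On (f a t c') c' := fun hh => by
    have := h.window_unique hc1.le (hw' c' hc1.le (by linarith)) hh (hon c' hc1 hc3.le) hc1.le le_rfl
    linarith
  obtain ⟨r, hr1, hr2, -, -, hr⟩ := (h.sp3 a t).exists_right hno' ((h.sp3 a t).fix hv) hc4
  have hx := hr ((c' + 3 * r) / 4) (by linarith) (by linarith)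
  obtain ⟨u', v', hu', hv', hu1', -, htv', hvc'⟩ :=
    h.exists_window (a := a) (b := t) (c := (c' + 3 * r) / 4) (by linarith)
      (hw' _ (by linarith) (by linarith))
  rcases hx.eq_or hu' hv' (by linarith) with hh | hh <;> linarith

/-- The set of locations at which the second agent wins on the right extends to the right by a
fixed fraction of the distance to the first agent. -/
lemma winsRight_of_window (h : Nice3 f ρ) {a t b c : ℝ} (ht : WinsRight f a t)
    (hw : (ρ + 1) * (c - t) < t - a) (htb : t < b) (hbc : b < c) : WinsRight f a b := by
  have hρ := h.one_le
  have hw' : ∀ x, t ≤ x → x ≤ c → (ρ + 1) * (c - x) < x - a := fun x h1 h2 => by nlinarith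
  have htc := htb.trans hbc
  have htI := h.on_of_winsRight_of_window htc hw ht
  refine h.winsRight_of_on hbc (hw' b htb.le hbc.le) ?_
  by_contra hno
  obtain ⟨l, r, hl, hlb, hbr, hrc, -, -, hgap, hleft, -⟩ :=
    (h.sp2 a c).exists_gap htI hno (h.on_of_eq_right a c (by tauto)) htb hbc
  have hx := hleft ((3 * l + r) / 4) (by linarith) (by linarith) (by linarith)
  obtain ⟨u', v', hu', hv', hu1', hu2, htv', hvc'⟩ :=
    h.exists_window (a := a) (b := (3 * l + r) / 4) (c := c) (by linarith)
      (hw' _ (by linarith) (by linarith))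
  have hu3 := abs_le.1 hu2
  rcases hx.eq_or hu' hv' (by linarith) with hh | hh
  · nlinarith
  · linarith

/-- The set of locations at which the second agent wins on the right is an upper set. -/
lemma winsRight_mono (h : Nice3 f ρ) {a t b : ℝ} (ht : WinsRight f a t) (htb : t ≤ b) :
    WinsRight f a b := by
  have hρ := h.one_le
  have hat := ht.1
  have hδ : 0 < (t - a) / (4 * (ρ + 1)) := by apply div_pos <;> linarith
  have hδ' : (ρ + 1) * ((t - a) / (4 * (ρ + 1))) = (t - a) / 4 := by field_simp
  refine step_induction (S := WinsRight f a) hδ (fun s x hs hsx hx _ hS => ?_) ht htb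
  rcases hsx.eq_or_lt with he | hlt
  · rwa [← he]
  · exact h.winsRight_of_window (c := s + 2 * ((t - a) / (4 * (ρ + 1)))) hS
      (by nlinarith) hlt (by linarith)

/-- An agent who wins against a close competitor on her right wins against any competitor on her
right. -/
lemma on_of_winsRight (h : Nice3 f ρ) {a t c : ℝ} (ht : WinsRight f a t) (htc : t < c) :
    On (f a t c) t := by
  have hρ := h.one_le
  by_contra hno
  obtain ⟨r, htr, hrc, -, -, hr⟩ :=
    (h.sp2 a c).exists_right hno (h.on_of_eq_right a c (t := c) (by tauto)) htc
  have hat := ht.1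
  set δ := min ((r - t) / 4) ((t - a) / (2 * (ρ + 1))) with hδ
  have hδ0 : 0 < δ := lt_min (by linarith) (by apply div_pos <;> linarith)
  have hδ1 : δ ≤ (r - t) / 4 := min_le_left _ _
  have hδ2 : (ρ + 1) * δ ≤ (t - a) / 2 := by
    calc (ρ + 1) * δ ≤ (ρ + 1) * ((t - a) / (2 * (ρ + 1))) := by
          gcongr; exact min_le_right _ _
      _ = _ := by field_simp
  have hw : (ρ + 1) * (r - (r - δ)) < (r - δ) - a := by
    rw [sub_sub_cancel]; linarith
  have h1 : On (f a (r - δ) r) r := (h.sp3 a (r - δ)).fix (hr (r - δ) (by linarith) (by linarith))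
  have h2 := h.on_of_winsRight_of_window (by linarith) hw
    (h.winsRight_mono ht (b := r - δ) (by linarith))
  have := h.window_unique (by linarith) hw h1 h2 (by linarith) le_rfl
  linarith

/-- A middle agent who gets a facility wins on the right or, in the mirror image, on the left: the
facility at her location is the nearest one for at least one of her two neighbours, and this remains
so when that neighbour approaches. -/
lemma winsRight_or (h : Nice3 f ρ) {a t c : ℝ} (hat : a < t) (htc : t < c)
    (ht : On (f a t c) t) : WinsRight f a t ∨ WinsRight (FacilityLocation.refl3 f) (-c) (-t) := by
  by_cases hc : ∀ s, On (f a t c) s → |c - t| ≤ |c - s|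
  · left
    exact ⟨hat, c, htc, fun c' h1 h2 => (h.sp3 a t).toward ht hc (by grind)⟩
  · right
    push Not at hc
    obtain ⟨s, hs, hcs⟩ := hc
    refine ⟨neg_lt_neg htc, -a, neg_lt_neg hat, fun a' h1 h2 => ?_⟩
    simp only [FacilityLocation.refl3, on_negOutcome, neg_neg]
    refine (h.sp1 t c).toward ht (fun r hr => ?_) (by grind)
    rcases hr.eq_or ht hs (by grind) with hh | hh
    · rw [hh]
    · grind

/-- A gap of the locations available to the middle agent, with left end `l`, bounds the distance from
`l` to the first agent: when the middle agent is just to the right of `l`, the facilities are at `l`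
and beyond the gap, so the first agent has to go to `l`. -/
lemma sub_le_of_gap (h : Nice3 f ρ) {a s b c : ℝ} (has : a ≤ s) (hsb : s < b) (hbc : b < c)
    (hs : On (f a s c) s) (hb : ¬ On (f a b c) b) : s - a ≤ ρ * (c - s) := by
  have hρ := h.one_le
  obtain ⟨l, r, hl, hlb, hbr, hrc, -, -, hgap, hleft, -⟩ :=
    (h.sp2 a c).exists_gap hs hb (h.on_of_eq_right a c (by tauto)) hsb hbc
  have hx := hleft ((3 * l + r) / 4) (by linarith) (by linarith) (by linarith)
  obtain ⟨u, v, hu, hv, hub, hbv⟩ := h.exists_split (a := a) (b := (3 * l + r) / 4) (c := c)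
    (by linarith) (by linarith) (hgap _ (by linarith) (by linarith))
  have hul : u = l := by
    rcases hx.eq_or hu hv (by linarith) with hh | hh <;> linarith
  obtain ⟨w, hw, hw'⟩ := exists_nearest a (f a ((3 * l + r) / 4) c)
  have h1 := h.cost_le_right a ((3 * l + r) / 4) c (t := a) (by tauto)
  rw [hw'] at h1
  have h2 : l ≤ w := by
    rcases hw.eq_or hu hv (by linarith) with hh | hh <;> linarith
  rw [abs_sub_comm a, abs_of_nonneg (by linarith), abs_sub_comm, abs_of_nonneg (by linarith)] at h1
  nlinarith

/-- The second and the third agent cannot both win on the right: otherwise the leftmost of the two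
would always get a facility, and the other one could profit from joining her. -/
lemma not_winsRight_swap23 (h : Nice3 f ρ) {a t t' : ℝ} (ht : WinsRight f a t)
    (ht' : WinsRight (FacilityLocation.swap23 f) a t') : False := by
  have hρ := h.one_le
  have hb := h.winsRight_mono ht (le_max_left t t')
  have hb' := h.swap23.winsRight_mono ht' (le_max_right t t')
  set b := max t t'
  have hab := hb.1
  have hδ : 0 < (b - a) / (2 * (ρ + 1)) := by apply div_pos <;> linarith
  have hδ' : (ρ + 1) * ((b - a) / (2 * (ρ + 1))) = (b - a) / 2 := by field_simp
  set δ := (b - a) / (2 * (ρ + 1))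
  have hno : ¬ On (f a b (b + δ)) (b + δ) := fun hh => by
    have := h.window_unique (a := a) (b := b) (c := b + δ) (by linarith)
      (by rw [add_sub_cancel_left]; linarith) hh (h.on_of_winsRight hb (by linarith))
      (by linarith) le_rfl
    linarith
  -- The third agent has a gap just to the right of `b`, which ends somewhere since her cost is
  -- bounded. Just to the left of its end `r`, she attracts a facility to `r`, where the second agent
  -- wants to go; but there the third agent wins against her.
  obtain ⟨s, hs, hs'⟩ := exists_nearest (b + δ + ρ * (b - a) + 1) (f a b (b + δ + ρ * (b - a) + 1))
  have h1 := h.cost_le_left a b (b + δ + ρ * (b - a) + 1)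
    (t := b + δ + ρ * (b - a) + 1) (by tauto)
  rw [hs', abs_sub_comm a, abs_of_pos (sub_pos.2 hab)] at h1
  have h2 := (abs_le.1 h1).2
  obtain ⟨r, hr1, hr2, -, -, hr⟩ := (h.sp3 a b).exists_right hno ((h.sp3 a b).fix hs) (by linarith)
  set ε := min ((r - (b + δ)) / 4) δ with hε
  have hε0 : 0 < ε := lt_min (by linarith) hδ
  have hε1 : ε ≤ (r - (b + δ)) / 4 := min_le_left _ _
  have hε2 : ε ≤ δ := min_le_right _ _
  have hw : (ρ + 1) * (r - (r - ε)) < (r - ε) - a := by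
    rw [sub_sub_cancel]; nlinarith
  have h3 : On (f a r (r - ε)) r := (h.sp2 a (r - ε)).fix (hr (r - ε) (by linarith) (by linarith))
  have h4 := h.swap23.on_of_winsRight_of_window (by linarith) hw
    (h.swap23.winsRight_mono hb' (b := r - ε) (by linarith))
  have := h.swap23.window_unique (by linarith) hw h3 h4 (by linarith) le_rfl
  linarith

end Nice3

/-! ### The middle agent of three wins always or never -/

namespace Nice3

variable {f : ℝ → ℝ → ℝ → ℝ × ℝ} {ρ : ℝ}

lemma refl3_neg {a b c t : ℝ} :
    On (FacilityLocation.refl3 f (-c) (-b) (-a)) (-t) ↔ On (f a b c) t := by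
  simp only [FacilityLocation.refl3, on_negOutcome, neg_neg]

lemma on_of_winsLeft (h : Nice3 f ρ) {a t c : ℝ}
    (ht : WinsRight (FacilityLocation.refl3 f) (-c) (-t)) (hat : a < t) : On (f a t c) t :=
  refl3_neg.1 (h.refl3.on_of_winsRight ht (neg_lt_neg hat))

lemma sub_le_of_gap_left (h : Nice3 f ρ) {a s b c : ℝ} (hab : a < b) (hbs : b < s) (hsc : s ≤ c)
    (hs : On (f a s c) s) (hb : ¬ On (f a b c) b) : c - s ≤ ρ * (s - a) := by
  have := h.refl3.sub_le_of_gap (neg_le_neg hsc) (neg_lt_neg hbs) (neg_lt_neg hab)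
    (refl3_neg.2 hs) (fun hh => hb (refl3_neg.1 hh))
  linarith

/-- If a gap of the locations available to the middle agent starts at `l`, to the right of the first
agent, then the third agent wins on the right when she is at `l`. -/
lemma winsRight_swap23_of_gap (h : Nice3 f ρ) {a l r c : ℝ} (hal : a < l) (hlr : l < r)
    (hleft : ∀ t, l < t → t < r → t - l < r - t → On (f a t c) l) :
    WinsRight (FacilityLocation.swap23 f) a l := by
  have hρ := h.one_le
  set δ := min ((r - l) / 4) ((l - a) / (2 * (ρ + 1))) with hδ
  have hδ0 : 0 < δ := lt_min (by linarith) (by apply div_pos <;> linarith)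
  have hδ1 : δ ≤ (r - l) / 4 := min_le_left _ _
  have hδ2 : (ρ + 1) * δ ≤ (l - a) / 2 := by
    calc (ρ + 1) * δ ≤ (ρ + 1) * ((l - a) / (2 * (ρ + 1))) := by
          gcongr; exact min_le_right _ _
      _ = _ := by field_simp
  refine h.swap23.winsRight_of_on (c := l + δ) (by linarith)
    (by rw [add_sub_cancel_left]; linarith) ?_
  exact (h.sp3 a (l + δ)).fix (hleft (l + δ) (by linarith) (by linarith) (by linarith))

/-- The locations available to the middle agent do not break off strictly between the other two
agents. If they broke off at `l`, then the third agent would win on the right for the first agent at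
`a`, while the second agent would win on the right for the first agent at some `a₁` far to the left.
For the third agent in the middle and the second one far to the right, this produces a gap for the
first agent at `a₁`. Its start attracts a facility which remains there when the first agent moves
from `a₁` to `a`; so the second agent wins on the right for the first agent at `a` as well,
contradicting `not_winsRight_swap23`. -/
lemma on_of_on_left (h : Nice3 f ρ) {a p b c : ℝ} (hap : a < p) (hpb : p < b) (hbc : b < c)
    (hp : On (f a p c) p) : On (f a b c) b := by
  have hρ := h.one_le
  by_contra hb
  obtain ⟨l, r, hl, hlb, hbr, hrc, hlI, -, hgap, hleft, -⟩ :=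
    (h.sp2 a c).exists_gap hp hb (h.on_of_eq_right a c (by tauto)) hpb hbc
  have hg := h.winsRight_swap23_of_gap (by linarith) (by linarith) hleft
  have hnf : ∀ t, ¬ WinsRight f a t := fun t ht => h.not_winsRight_swap23 ht hg
  have hpl := (h.winsRight_or hap (hpb.trans hbc) hp).resolve_left (hnf p)
  -- When the first agent is far to the left, the second agent gets a facility at `b` and wins on
  -- the right, because the gap would be too expensive.
  set a₁ := a - ρ * (c - p) - 1 with ha₁
  have haa : a₁ < a := by nlinarith
  have hb₁ : On (f a₁ b c) b := by
    by_contra hno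
    have := h.sub_le_of_gap (by linarith) hpb hbc (h.on_of_winsLeft hpl (by linarith)) hno
    linarith
  have hf₁ : WinsRight f a₁ b := (h.winsRight_or (by linarith) hbc hb₁).resolve_right
    (fun hh => hb (h.on_of_winsLeft hh (by linarith)))
  have hng : ∀ t, ¬ WinsRight (FacilityLocation.swap23 f) a₁ t :=
    fun t ht => h.not_winsRight_swap23 hf₁ ht
  set g := FacilityLocation.swap23 f with hgdef
  have hG : Nice3 g ρ := h.swap23
  -- For `d` far to the right and `e` much farther, the third agent at `d` gets a facility, whether
  -- the first agent is at `a` or at `a₁`.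
  set d := l + (a - a₁) + 1 with hd
  have hld : l < d := by linarith
  have had : 2 * a - a₁ < d := by linarith
  have hgd : WinsRight g a d := hG.winsRight_mono hg hld.le
  set e := a₁ + (1 + ρ) * (2 * (d - a₁)) + 1 with he
  have hde : d < e := by nlinarith
  have hde' : ρ * (d - a) < e - d := by nlinarith
  have hd₁ : On (g a₁ d e) d := by
    by_contra hno
    obtain ⟨l', r', hl', hld', hdr', hre', hlI', hrI', hgap', hleft', -⟩ :=
      (hG.sp2 a₁ e).exists_gap (hG.on_of_eq_left a₁ e (by tauto)) hno
        (hG.on_of_eq_right a₁ e (by tauto)) (by linarith) hde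
    have h1 := hG.sub_le_of_gap_left (by linarith) hdr' hre' hrI' hno
    have h2 : On (g a₁ d e) l' := hleft' d hld' hdr' (by nlinarith)
    have h3 : On (g a d e) d := hG.on_of_winsRight hgd hde
    obtain ⟨s, hs, hs'⟩ := (hG.sp1 d e).near h2 a
    have hsd : s < d := by grind
    obtain ⟨w, hw, hw'⟩ := exists_nearest e (g a d e)
    have h4 := hG.cost_le_left a d e (t := e) (by tauto)
    rw [hw', abs_sub_comm a d, abs_of_pos (show 0 < d - a by linarith)] at h4
    have h5 := le_abs_self (e - w)
    rcases hw.eq_or hs h3 hsd.ne with hh | hh <;> linarith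
  -- Hence there is a gap of the locations available to the third agent which starts beyond `d`.
  set δ := (d - a₁) / (2 * (ρ + 1)) with hδ
  have hδ0 : 0 < δ := by apply div_pos <;> linarith
  have hδ' : (ρ + 1) * δ = (d - a₁) / 2 := by rw [hδ]; field_simp
  have hδe : d < e - δ := by nlinarith
  have hno : ¬ On (g a₁ (e - δ) e) (e - δ) := fun hh =>
    hng _ (hG.winsRight_of_on (c := e) (by linarith) (by rw [sub_sub_cancel]; linarith) hh)
  obtain ⟨l', r', hl', hld', hdr', hre', hlI', hrI', hgap', hleft', -⟩ :=
    (hG.sp2 a₁ e).exists_gap hd₁ hno (hG.on_of_eq_right a₁ e (by tauto)) hδe (by linarith)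
  -- The second agent wins at the start of that gap, also when the first agent is at `a`.
  set η := min ((r' - l') / 4) ((l' - a) / (2 * (ρ + 1))) with hη
  have hη0 : 0 < η := lt_min (by linarith) (by apply div_pos <;> linarith)
  have hη1 : η ≤ (r' - l') / 4 := min_le_left _ _
  have hη2 : (ρ + 1) * η ≤ (l' - a) / 2 := by
    calc (ρ + 1) * η ≤ (ρ + 1) * ((l' - a) / (2 * (ρ + 1))) := by
          gcongr; exact min_le_right _ _
      _ = _ := by field_simp
  have h1 : On (g a₁ (l' + η) e) l' := hleft' _ (by linarith) (by linarith) (by linarith)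
  obtain ⟨u, v, hu, hv, hub, hbv⟩ := hG.exists_split (a := a₁) (b := l' + η) (c := e)
    (by linarith) (by linarith) (hgap' _ (by linarith) (by linarith))
  have h2 : On (g a (l' + η) e) l' := by
    refine (hG.sp1 (l' + η) e).toward h1 (fun s hs => ?_) (by grind)
    rcases hs.eq_or h1 hv (by linarith) with hh | hh
    · rw [hh]
    · grind
  have h3 : On (f a l' (l' + η)) l' := (h.sp2 a (l' + η)).fix (z := e) h2
  exact hnf l' (h.winsRight_of_on (c := l' + η) (by linarith)
    (by rw [add_sub_cancel_left]; linarith) h3)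

lemma on_of_on (h : Nice3 f ρ) {a p b c : ℝ} (hap : a < p) (hpc : p < c) (hab : a < b) (hbc : b < c)
    (hp : On (f a p c) p) : On (f a b c) b := by
  rcases lt_trichotomy p b with hpb | rfl | hbp
  · exact h.on_of_on_left hap hpb hbc hp
  · exact hp
  · exact refl3_neg.1 (h.refl3.on_of_on_left (neg_lt_neg hpc) (neg_lt_neg hbp) (neg_lt_neg hab)
      (refl3_neg.2 hp))

end Nice3

/-- The middle agent always gets a facility when the agents are ordered as listed. -/
def MiddleWins (f : ℝ → ℝ → ℝ → ℝ × ℝ) : Prop := ∀ a b c, a < b → b < c → On (f a b c) b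

lemma middleWins_refl3 {f : ℝ → ℝ → ℝ → ℝ × ℝ} : MiddleWins (refl3 f) ↔ MiddleWins f := by
  constructor
  · intro h a b c hab hbc
    exact Nice3.refl3_neg.1 (h _ _ _ (neg_lt_neg hbc) (neg_lt_neg hab))
  · intro h a b c hab hbc
    have := h _ _ _ (neg_lt_neg hbc) (neg_lt_neg hab)
    simpa only [refl3, on_negOutcome] using this

namespace Nice3

variable {f : ℝ → ℝ → ℝ → ℝ × ℝ} {ρ : ℝ}

/-- Some middle agent getting a facility is a property that does not depend on the location of the
first agent. -/
lemma on_of_on_change_left (h : Nice3 f ρ) {a b c a' b' : ℝ} (hab : a < b) (hbc : b < c)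
    (hb : On (f a b c) b) (hab' : a' < b') (hbc' : b' < c) : On (f a' b' c) b' := by
  have hρ := h.one_le
  set S : ℝ → Prop := fun t => WinsRight (FacilityLocation.refl3 f) (-c) (-t) with hS
  have hfull : ∀ s x y, S s → x < s → s < c → x < y → y < c → On (f x y c) y :=
    fun s x y hs hxs hsc hxy hyc => h.on_of_on hxs hsc hxy hyc (h.on_of_winsLeft hs hxs)
  have hstart : ∀ x y, x < y → y < c → (ρ + 1) * (y - x) < c - y → On (f x y c) y → S y :=
    fun x y hxy _ hw hon => h.refl3.winsRight_of_on (neg_lt_neg hxy) (by linarith)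
      (refl3_neg.2 hon)
  -- the second agent wins on the left when she is close to `a`, and from there on up to `c`
  set t := a + (c - a) / (2 * (ρ + 2)) with ht
  have h0 : 0 < (c - a) / (2 * (ρ + 2)) := by apply div_pos <;> linarith
  have h0' : (ρ + 2) * ((c - a) / (2 * (ρ + 2))) = (c - a) / 2 := by field_simp
  have hat : a < t := by linarith
  have htc : t < c := by nlinarith
  have hSt : S t := hstart a t hat htc (by rw [ht]; linarith)
    (h.on_of_on hab hbc hat htc hb)
  set B := max t ((a' + c) / 2) with hB
  have hac' : a' < c := hab'.trans hbc'
  have hBc : B < c := max_lt htc (by linarith)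
  have hSB : S B := by
    have hδ0 : 0 < (c - B) / (4 * (ρ + 1)) := by apply div_pos <;> linarith
    have hδ' : (ρ + 1) * ((c - B) / (4 * (ρ + 1))) = (c - B) / 4 := by field_simp
    refine step_induction (S := S) hδ0 (fun s x _ hsx hx hxB hs => ?_) hSt (le_max_left _ _)
    exact hstart (s - (c - B) / (4 * (ρ + 1))) x (by linarith) (by linarith) (by nlinarith)
      (hfull s _ x hs (by linarith) (by linarith) (by linarith) (by linarith))
  exact hfull B a' b' hSB (lt_of_lt_of_le (by linarith) (le_max_right _ _)) hBc hab' hbc'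

/-- Either the middle agent always gets a facility, or she never does. -/
lemma middleWins_of_on (h : Nice3 f ρ) {a b c : ℝ} (hab : a < b) (hbc : b < c)
    (hb : On (f a b c) b) : MiddleWins f := by
  have hR : ∀ a b c b' c', a < b → b < c → a < b' → b' < c' → On (f a b c) b →
      On (f a b' c') b' := by
    intro a b c b' c' h1 h2 h3 h4 hon
    exact refl3_neg.1 (h.refl3.on_of_on_change_left (neg_lt_neg h2) (neg_lt_neg h1)
      (refl3_neg.2 hon) (neg_lt_neg h4) (neg_lt_neg h3))
  intro a' b' c' hab' hbc'
  have h1 : min a a' - 1 < a := by linarith [min_le_left a a']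
  have h2 : min a a' - 1 < a' := by linarith [min_le_right a a']
  have h3 := h.on_of_on_change_left hab hbc hb (h1.trans hab) hbc
  have h4 := hR _ _ _ b' c' (h1.trans hab) hbc (h2.trans hab') hbc' h3
  exact h.on_of_on_change_left (h2.trans hab') hbc' h4 hab' hbc'

/-- If the middle agent does not get a facility, then both outer agents do. -/
lemma on_left_of_not_middleWins (h : Nice3 f ρ) (hf : ¬ MiddleWins f) {a b c : ℝ} (hab : a < b)
    (hbc : b < c) : On (f a b c) a := by
  by_contra ha
  obtain ⟨r, hr1, hr2, -, -, hr⟩ :=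
    (h.sp1 b c).exists_right ha (h.on_of_eq_left b c (t := b) (by tauto)) hab
  have h1 := hr ((a + 3 * r) / 4) (by linarith) (by linarith)
  exact hf (h.middleWins_of_on (a := (a + 3 * r) / 4) (b := r) (c := c) (by linarith)
    (by linarith) ((h.sp2 _ c).fix h1))

lemma on_right_of_not_middleWins (h : Nice3 f ρ) (hf : ¬ MiddleWins f) {a b c : ℝ} (hab : a < b)
    (hbc : b < c) : On (f a b c) c :=
  refl3_neg.1 (h.refl3.on_left_of_not_middleWins (mt middleWins_refl3.1 hf) (neg_lt_neg hbc)
    (neg_lt_neg hab))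

lemma not_middleWins_swap23 (h : Nice3 f ρ) (hf : MiddleWins f)
    (hf' : MiddleWins (FacilityLocation.swap23 f)) : False :=
  h.not_winsRight_swap23 (a := 0) (t := 1) (t' := 1)
    ⟨one_pos, 2, one_lt_two, fun c hc _ => hf 0 1 c one_pos hc⟩
    ⟨one_pos, 2, one_lt_two, fun c hc _ => hf' 0 1 c one_pos hc⟩

end Nice3

/-! ### Mechanisms for four groups of agents -/

/-- A strategyproof mechanism for four groups of agents with bounded individual cost. -/
structure Nice4 (f : ℝ → ℝ → ℝ → ℝ → ℝ × ℝ) (ρ : ℝ) : Prop where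
  one_le : 1 ≤ ρ
  sp1 : ∀ x y c, SP1 (fun a => f a x y c)
  sp2 : ∀ a y c, SP1 (fun x => f a x y c)
  sp3 : ∀ a x c, SP1 (fun y => f a x y c)
  sp4 : ∀ a x y, SP1 (fun c => f a x y c)
  bound : ∀ a x y c t, t = a ∨ t = x ∨ t = y ∨ t = c → ∀ z, agentCost t (f a x y c) ≤
    ρ * (agentCost a z + agentCost x z + agentCost y z + agentCost c z)

namespace Nice4

variable {f : ℝ → ℝ → ℝ → ℝ → ℝ × ℝ} {ρ : ℝ}

/-- If the third group wins while the second group joins the first, then the second and the third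
group win together. Otherwise, for these two groups close to the first, the second group could also
attract a facility to the first, and the fourth group would be left without one nearby. -/
lemma false_of_merge_left (h : Nice4 f ρ) (hy : ∀ a y c, a < y → y < c → On (f a a y c) y)
    (ha : ∀ a x c, a < x → x < c → On (f a x x c) a) : False := by
  have hρ := h.one_le
  have hε : 0 < 1 / (2 * (ρ + 1)) := by positivity
  have hε' : (ρ + 1) * (1 / (2 * (ρ + 1))) = 1 / 2 := by field_simp
  set ε := 1 / (2 * (ρ + 1))
  have hε1 : ε < 1 := by nlinarith
  have h1 := hy 0 ε 1 hε hε1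
  have h2 : On (f 0 0 ε 1) 0 := (h.sp2 0 ε 1).fix (z := ε) (ha 0 ε 1 hε hε1)
  obtain ⟨w, hw, hw'⟩ := exists_nearest 1 (f 0 0 ε 1)
  have h3 := h.bound 0 0 ε 1 1 (by tauto) (0, 1)
  have h4 : agentCost 0 (0, 1) = 0 := agentCost_eq_zero (Or.inl rfl)
  have h5 : agentCost 1 (0, 1) = 0 := agentCost_eq_zero (Or.inr rfl)
  have h6 : agentCost ε (0, 1) ≤ |ε - 0| := On.agentCost_le (Or.inl rfl) ε
  rw [sub_zero, abs_of_pos hε] at h6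
  rw [hw', h4, h5] at h3
  have h7 : |1 - w| ≤ ρ * ε := h3.trans (by nlinarith)
  rcases hw.eq_or h1 h2 hε.ne' with hh | hh <;> rw [hh, abs_of_nonneg (by linarith)] at h7 <;>
    nlinarith

/-- If two adjacent middle groups win when united, then one of them wins when the other one joins
the outer group on its side. Otherwise the third group, between the second and the fourth, gets a
facility whenever the fourth group is close; by strategyproofness for the fourth group this persists
when that group moves away by a constant factor, hence for ever, at unbounded cost. -/
lemma false_of_split_middle (h : Nice4 f ρ)
    (h1 : ∀ a y c, a < y → y < c → On (f a a y c) a ∧ On (f a a y c) c)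
    (h2 : ∀ a x c, a < x → x < c → On (f a x c c) a ∧ On (f a x c c) c)
    (h3 : ∀ a x c, a < x → x < c → On (f a x x c) x) : False := by
  have hρ := h.one_le
  -- the costs of the outer groups are bounded by what they get when they join their neighbours
  have hA : ∀ a x y c, x < y → y < c → ∃ s, On (f a x y c) s ∧ |a - s| ≤ |a - x| :=
    fun a x y c hxy hyc => (h.sp1 x y c).near (h1 x y c hxy hyc).1 a
  have hC : ∀ a x y c, a < x → x < y → ∃ s, On (f a x y c) s ∧ |c - s| ≤ |c - y| :=
    fun a x y c hax hxy => (h.sp4 a x y).near (h2 a x y hax hxy).2 c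
  have hYx : ∀ a x y c, a < x → x < y → y < c →
      ∃ u, On (f a x y c) u ∧ u ≤ x := by
    intro a x y c hax hxy hyc
    obtain ⟨u, hu, hu'⟩ := hA a x y c hxy hyc
    exact ⟨u, hu, by grind⟩
  have hYc : ∀ a x y c, a < x → x < y → y < c → On (f a x y c) y →
      ∀ s, On (f a x y c) s → c - y ≤ |c - s| := by
    intro a x y c hax hxy hyc hy s hs
    obtain ⟨u, hu, hux⟩ := hYx a x y c hax hxy hyc
    rcases hs.eq_or hu hy (by linarith) with hh | hh <;> grind
  have hYbound : ∀ a x y c, a < x → x < y → y < c → On (f a x y c) y →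
      c - y ≤ 2 * ρ * (y - a) := by
    intro a x y c hax hxy hyc hy
    obtain ⟨w, hw, hw'⟩ := exists_nearest c (f a x y c)
    have e1 := hYc a x y c hax hxy hyc hy w hw
    have e2 := h.bound a x y c c (by tauto) (y, c)
    have e3 : agentCost y (y, c) = 0 := agentCost_eq_zero (Or.inl rfl)
    have e4 : agentCost c (y, c) = 0 := agentCost_eq_zero (Or.inr rfl)
    have e5 : agentCost a (y, c) ≤ |a - y| := On.agentCost_le (Or.inl rfl) a
    have e6 : agentCost x (y, c) ≤ |x - y| := On.agentCost_le (Or.inl rfl) x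
    rw [abs_sub_comm, abs_of_pos (by linarith)] at e5 e6
    rw [hw', e3, e4] at e2
    nlinarith
  have hXbound : ∀ a x y c, a < x → x < y → y < c → On (f a x y c) x →
      x - a ≤ 2 * ρ * (c - x) := by
    intro a x y c hax hxy hyc hx
    obtain ⟨v, hv, hv'⟩ := hC a x y c hax hxy
    have hvy : y ≤ v := by grind
    obtain ⟨w, hw, hw'⟩ := exists_nearest a (f a x y c)
    have e1 : x - a ≤ |a - w| := by
      rcases hw.eq_or hx hv (by linarith) with hh | hh <;> grind
    have e2 := h.bound a x y c a (by tauto) (a, x)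
    have e3 : agentCost a (a, x) = 0 := agentCost_eq_zero (Or.inl rfl)
    have e4 : agentCost x (a, x) = 0 := agentCost_eq_zero (Or.inr rfl)
    have e5 : agentCost y (a, x) ≤ |y - x| := On.agentCost_le (Or.inr rfl) y
    have e6 : agentCost c (a, x) ≤ |c - x| := On.agentCost_le (Or.inr rfl) c
    rw [abs_of_pos (by linarith)] at e5 e6
    rw [hw', e3, e4] at e2
    nlinarith
  -- A gap of the locations available to the third group starts at the second group.
  have hgap : ∀ a x y c, a < x → x < y → y < c → ¬ On (f a x y c) y → ∃ r, y < r ∧ r ≤ c ∧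
      (∀ t, x < t → t < r → t - x < r - t → On (f a x t c) x) ∧
      (∀ t, x < t → t < r → r - t < t - x → On (f a x t c) r) := by
    intro a x y c hax hxy hyc hno
    obtain ⟨l, r, hl, hly, hyr, hrc, -, -, hgap, hleft, hright⟩ :=
      (h.sp3 a x c).exists_gap (h3 a x c hax (hxy.trans hyc)) hno
        (h2 a x c hax (hxy.trans hyc)).2 hxy hyc
    have hlx : l = x := by
      by_contra hne
      have hxl : x < l := lt_of_le_of_ne hl (Ne.symm hne)
      have hx := hleft ((3 * l + r) / 4) (by linarith) (by linarith) (by linarith)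
      obtain ⟨s, hs, hs'⟩ := hC a x ((3 * l + r) / 4) c hax (by linarith)
      have hls : l < s := by grind
      obtain ⟨u, hu, hu'⟩ := hA a x ((3 * l + r) / 4) c (by linarith) (by linarith)
      rcases hu.eq_or hx hs hls.ne with hh | hh <;> grind
    subst hlx
    exact ⟨r, hyr, hrc, hleft, hright⟩
  -- From now on the first group is at `0` and the second at `1`; `G c` says that there is no gap for
  -- the third group when the fourth is at `c`.
  set G : ℝ → Prop := fun c => ∀ y, 1 < y → y < c → On (f 0 1 y c) y with hG
  have hδ : 0 < 1 / (4 * ρ) := by positivity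
  have hδ' : ρ * (1 / (4 * ρ)) = 1 / 4 := by field_simp
  set δ := 1 / (4 * ρ)
  have hstart : G (1 + δ) := by
    intro y hy1 hy2
    by_contra hno
    obtain ⟨r, hr1, hr2, hleft, -⟩ := hgap 0 1 y (1 + δ) one_pos hy1 hy2 hno
    have := hXbound 0 1 ((3 + r) / 4) (1 + δ) one_pos (by linarith) (by linarith)
      (hleft _ (by linarith) (by linarith) (by linarith))
    nlinarith
  have hall : G (1 + δ + 4 * ρ + 2) := by
    refine step_induction (S := G) (t := 1 + δ) (δ := δ / 4) (by linarith) ?_ hstart (by linarith)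
    intro c₁ c₂ hc1 hc12 hc2 _ hGc y hy1 hy2
    by_contra hno
    obtain ⟨r, hr1, hr2, -, hright⟩ := hgap 0 1 y c₂ one_pos hy1 hy2 hno
    -- With the third group at `t`, the fourth group at `c₁` is served at `t`, but the report `c₂`
    -- would give it a facility at `r`, which is closer.
    obtain ⟨t, ht1, ht2⟩ := exists_between
      (show (1 + r) / 2 < min r (min c₁ (2 * c₁ - r)) from
        lt_min (by linarith) (lt_min (by linarith) (by linarith)))
    have ht3 := ht2.trans_le (min_le_left _ _)
    have ht4 := ht2.trans_le ((min_le_right _ _).trans (min_le_left _ _))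
    have ht5 := ht2.trans_le ((min_le_right _ _).trans (min_le_right _ _))
    have e1 := hright t (by linarith) ht3 (by linarith)
    obtain ⟨s, hs, hs'⟩ := (h.sp4 0 1 t).near e1 c₁
    have e2 := hYc 0 1 t c₁ one_pos (by linarith) ht4 (hGc t (by linarith) ht4) s hs
    grind
  have := hYbound 0 1 2 _ one_pos one_lt_two (by linarith) (hall 2 one_lt_two (by linarith))
  linarith

end Nice4

/-! ### Winning middle groups among `n` agents -/

variable {n : ℕ}

/-- A strategyproof mechanism for `n` agents such that the cost of every single agent is at most `ρ`
times the social cost of any outcome. -/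
structure NiceN (f : (Fin n → ℝ) → ℝ × ℝ) (ρ : ℝ) : Prop where
  one_le : 1 ≤ ρ
  sp : ∀ x i y, agentCost (x i) (f x) ≤ agentCost (x i) (f (Function.update x i y))
  bound : ∀ x i z, agentCost (x i) (f x) ≤ ρ * socialCost x z

/-- The instance where the agents in `A` are at `a`, those in `B` at `b`, all others at `c`. -/
def inst3 (A B : Finset (Fin n)) (a b c : ℝ) : Fin n → ℝ :=
  fun i => if i ∈ A then a else if i ∈ B then b else c

/-- The instance where the agents in `A` are at `a`, those in `X` at `x`, those in `Y` at `y`, all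
others at `c`. -/
def inst4 (A X Y : Finset (Fin n)) (a x y c : ℝ) : Fin n → ℝ :=
  fun i => if i ∈ A then a else if i ∈ X then x else if i ∈ Y then y else c

/-- The sets `A`, `B` and the complement of their union form a partition of the agents into three
groups. -/
structure IsPart (A B : Finset (Fin n)) : Prop where
  left : A.Nonempty
  mid : B.Nonempty
  disj : Disjoint A B
  right : (A ∪ B)ᶜ.Nonempty

/-- The group `B` always gets a facility when it is between the group `A`, on its left, and the
group of all other agents, on its right. -/
def Win (f : (Fin n → ℝ) → ℝ × ℝ) (A B : Finset (Fin n)) : Prop :=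
  MiddleWins (fun a b c => f (inst3 A B a b c))

/-- The mirror image of a mechanism. -/
def reflN (f : (Fin n → ℝ) → ℝ × ℝ) : (Fin n → ℝ) → ℝ × ℝ := fun x => negOutcome (f (-x))

lemma IsPart.rev {A B : Finset (Fin n)} (h : IsPart A B) : IsPart (A ∪ B)ᶜ B where
  left := h.right
  mid := h.mid
  disj := by
    rw [Finset.disjoint_right]; intro i hi; simp [hi]
  right := by
    obtain ⟨i, hi⟩ := h.left
    exact ⟨i, by simp [hi, Finset.disjoint_left.1 h.disj hi]⟩

lemma compl_compl_union {A B : Finset (Fin n)} (h : Disjoint A B) : ((A ∪ B)ᶜ ∪ B)ᶜ = A := by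
  ext i
  have := fun hi : i ∈ A => Finset.disjoint_left.1 h hi
  simp only [Finset.mem_compl, Finset.mem_union]
  tauto

namespace NiceN

variable {f : (Fin n → ℝ) → ℝ × ℝ} {ρ : ℝ}

lemma reflN (h : NiceN f ρ) : NiceN (reflN f) ρ where
  one_le := h.one_le
  sp x i y := by
    have h1 := h.sp (-x) i (-y)
    have h2 : Function.update (-x) i (-y) = -Function.update x i y := by
      ext k
      by_cases hk : k = i
      · subst hk; simp
      · simp [Function.update_of_ne hk]
    rw [h2] at h1
    simpa only [FacilityLocation.reflN, agentCost_negOutcome, Pi.neg_apply] using h1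
  bound x i z := by
    have h1 := h.bound (-x) i (negOutcome z)
    have h2 : socialCost (-x) (negOutcome z) = socialCost x z := by
      simp [socialCost, agentCost_negOutcome]
    rw [h2] at h1
    simpa only [FacilityLocation.reflN, agentCost_negOutcome, Pi.neg_apply] using h1

/-- Partial group strategyproofness: agents sharing a location cannot gain by misreporting
jointly. -/
lemma group_sp (h : NiceN f ρ) (S : Finset (Fin n)) {s : ℝ} {x : Fin n → ℝ} :
    ∀ x' : Fin n → ℝ, (∀ i ∈ S, x i = s) → (∀ i ∉ S, x' i = x i) →
      agentCost s (f x) ≤ agentCost s (f x') := by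
  classical
  induction S using Finset.induction_on with
  | empty =>
    intro x' _ h2
    have : x' = x := funext fun i => h2 i (by simp)
    rw [this]
  | insert i S hi ih =>
    intro x' h1 h2
    refine (ih (Function.update x' i s) (fun k hk => h1 k (by simp [hk])) (fun k hk => ?_)).trans ?_
    · by_cases hki : k = i
      · subst hki; simp [h1 k (by simp)]
      · rw [Function.update_of_ne hki]
        exact h2 k (by simp [hki, hk])
    · have := h.sp (Function.update x' i s) i (x' i)
      simpa using this

/-- A group of agents sharing a location behaves like a single agent. -/
lemma sp1_of_group (h : NiceN f ρ) (S : Finset (Fin n)) (x : ℝ → Fin n → ℝ)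
    (hS : ∀ t, ∀ i ∈ S, x t i = t) (hx : ∀ t t', ∀ i ∉ S, x t i = x t' i) :
    SP1 (fun t => f (x t)) :=
  fun t t' => h.group_sp S (x t') (hS t) (hx t' t)

lemma nice3 (h : NiceN f ρ) {A B : Finset (Fin n)} (hP : IsPart A B) :
    Nice3 (fun a b c => f (inst3 A B a b c)) (ρ * n) where
  one_le := by
    have h1 := h.one_le
    obtain ⟨i, -⟩ := hP.left
    have h2 : (1 : ℝ) ≤ n := by exact_mod_cast Nat.one_le_iff_ne_zero.2 (Fin.pos i).ne'
    nlinarith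
  sp1 b c := h.sp1_of_group A _ (fun t i hi => by simp [inst3, hi])
    (fun t t' i hi => by simp [inst3, hi])
  sp2 a c := h.sp1_of_group B (fun b => inst3 A B a b c)
    (fun t i hi => by simp [inst3, hi, Finset.disjoint_right.1 hP.disj hi])
    (fun t t' i hi => by simp [inst3, hi])
  sp3 a b := h.sp1_of_group (A ∪ B)ᶜ (fun c => inst3 A B a b c)
    (fun t i hi => by simp_all [inst3])
    (fun t t' i hi => by
      rw [Finset.mem_compl, not_not, Finset.mem_union] at hi
      simp only [inst3]; grind)
  bound a b c t ht z := by
    have hi : ∃ i, inst3 A B a b c i = t := by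
      rcases ht with rfl | rfl | rfl
      · obtain ⟨i, hi⟩ := hP.left; exact ⟨i, by simp [inst3, hi]⟩
      · obtain ⟨i, hi⟩ := hP.mid
        exact ⟨i, by simp [inst3, hi, Finset.disjoint_right.1 hP.disj hi]⟩
      · obtain ⟨i, hi⟩ := hP.right; exact ⟨i, by simp_all [inst3]⟩
    obtain ⟨i, rfl⟩ := hi
    refine (h.bound (inst3 A B a b c) i z).trans ?_
    have h1 := h.one_le
    have ha := agentCost_nonneg a z
    have hb := agentCost_nonneg b z
    have hc := agentCost_nonneg c z
    have h2 : socialCost (inst3 A B a b c) z ≤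
        n * (agentCost a z + agentCost b z + agentCost c z) := by
      refine (Finset.sum_le_card_nsmul _ _
        (agentCost a z + agentCost b z + agentCost c z) fun k _ => ?_).trans_eq
          (by simp; ring)
      simp only [inst3]
      split_ifs <;> linarith
    rw [mul_assoc]
    gcongr

lemma nice4 (h : NiceN f ρ) {A X Y : Finset (Fin n)} (hA : A.Nonempty) (hX : X.Nonempty)
    (hY : Y.Nonempty) (hC : (A ∪ X ∪ Y)ᶜ.Nonempty) (hAX : Disjoint A X) (hAY : Disjoint A Y)
    (hXY : Disjoint X Y) : Nice4 (fun a x y c => f (inst4 A X Y a x y c)) (ρ * n) where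
  one_le := by
    have h1 := h.one_le
    obtain ⟨i, -⟩ := hA
    have h2 : (1 : ℝ) ≤ n := by exact_mod_cast Nat.one_le_iff_ne_zero.2 (Fin.pos i).ne'
    nlinarith
  sp1 x y c := h.sp1_of_group A _ (fun t i hi => by simp [inst4, hi])
    (fun t t' i hi => by simp [inst4, hi])
  sp2 a y c := h.sp1_of_group X (fun x => inst4 A X Y a x y c)
    (fun t i hi => by simp [inst4, hi, Finset.disjoint_right.1 hAX hi])
    (fun t t' i hi => by simp [inst4, hi])
  sp3 a x c := h.sp1_of_group Y (fun y => inst4 A X Y a x y c)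
    (fun t i hi => by
      simp [inst4, hi, Finset.disjoint_right.1 hAY hi, Finset.disjoint_right.1 hXY hi])
    (fun t t' i hi => by simp [inst4, hi])
  sp4 a x y := h.sp1_of_group (A ∪ X ∪ Y)ᶜ (fun c => inst4 A X Y a x y c)
    (fun t i hi => by simp_all [inst4])
    (fun t t' i hi => by
      rw [Finset.mem_compl, not_not, Finset.mem_union, Finset.mem_union] at hi
      simp only [inst4]; grind)
  bound a x y c t ht z := by
    have hi : ∃ i, inst4 A X Y a x y c i = t := by
      rcases ht with rfl | rfl | rfl | rfl
      · obtain ⟨i, hi⟩ := hA; exact ⟨i, by simp [inst4, hi]⟩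
      · obtain ⟨i, hi⟩ := hX
        exact ⟨i, by simp [inst4, hi, Finset.disjoint_right.1 hAX hi]⟩
      · obtain ⟨i, hi⟩ := hY
        exact ⟨i, by
          simp [inst4, hi, Finset.disjoint_right.1 hAY hi, Finset.disjoint_right.1 hXY hi]⟩
      · obtain ⟨i, hi⟩ := hC; exact ⟨i, by simp_all [inst4]⟩
    obtain ⟨i, rfl⟩ := hi
    refine (h.bound (inst4 A X Y a x y c) i z).trans ?_
    have h1 := h.one_le
    have ha := agentCost_nonneg a z
    have hb := agentCost_nonneg x z
    have hb' := agentCost_nonneg y z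
    have hc := agentCost_nonneg c z
    have h2 : socialCost (inst4 A X Y a x y c) z ≤
        n * (agentCost a z + agentCost x z + agentCost y z + agentCost c z) := by
      refine (Finset.sum_le_card_nsmul _ _
        (agentCost a z + agentCost x z + agentCost y z + agentCost c z) fun k _ => ?_).trans_eq
          (by simp; ring)
      simp only [inst4]
      split_ifs <;> linarith
    rw [mul_assoc]
    gcongr

end NiceN

lemma inst4_eq_mid (A X Y : Finset (Fin n)) (a x c : ℝ) :
    inst4 A X Y a x x c = inst3 A (X ∪ Y) a x c := by
  ext i; simp only [inst3, inst4, Finset.mem_union]; grind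

lemma inst4_eq_left (A X Y : Finset (Fin n)) (a y c : ℝ) :
    inst4 A X Y a a y c = inst3 (A ∪ X) Y a y c := by
  ext i; simp only [inst3, inst4, Finset.mem_union]; grind

lemma inst4_eq_right (A X Y : Finset (Fin n)) (a x c : ℝ) :
    inst4 A X Y a x c c = inst3 A X a x c := by
  ext i; simp only [inst3, inst4]; grind

lemma win_reflN {f : (Fin n → ℝ) → ℝ × ℝ} {A B : Finset (Fin n)} (h : Disjoint A B) :
    Win (reflN f) (A ∪ B)ᶜ B ↔ Win f A B := by
  have : (fun a b c => reflN f (inst3 (A ∪ B)ᶜ B a b c)) =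
      refl3 (fun a b c => f (inst3 A B a b c)) := by
    funext a b c
    have : -inst3 (A ∪ B)ᶜ B a b c = inst3 A B (-c) (-b) (-a) := by
      ext i
      have := fun hi : i ∈ A => Finset.disjoint_left.1 h hi
      simp only [inst3, Pi.neg_apply, Finset.mem_compl, Finset.mem_union]
      grind
    simp only [reflN, refl3, this]
  unfold Win
  rw [this, middleWins_refl3]

namespace NiceN

variable {f : (Fin n → ℝ) → ℝ × ℝ} {ρ : ℝ} {A B X Y : Finset (Fin n)}

lemma not_win_swap_right (h : NiceN f ρ) (hP : IsPart A B) (h1 : Win f A B)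
    (h2 : Win f A (A ∪ B)ᶜ) : False := by
  refine (h.nice3 hP).not_middleWins_swap23 h1 fun a b c hab hbc => ?_
  have h3 := h2 a b c hab hbc
  have : inst3 A (A ∪ B)ᶜ a b c = inst3 A B a c b := by
    ext i
    simp only [inst3, Finset.mem_compl, Finset.mem_union]
    grind
  simp only [this] at h3
  exact h3

lemma not_win_swap_left (h : NiceN f ρ) (hP : IsPart A B) (h1 : Win f A B)
    (h2 : Win f B A) : False := by
  refine h.reflN.not_win_swap_right hP.rev ((win_reflN hP.disj).2 h1) ?_
  rw [compl_compl_union hP.disj, Finset.union_comm]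
  exact (win_reflN hP.disj.symm).2 h2

/-- A winning middle group remains winning when it is joined by some agents of the left group. -/
lemma win_merge_left (h : NiceN f ρ) (hA : A.Nonempty) (hX : X.Nonempty)
    (hY : Y.Nonempty) (hC : (A ∪ X ∪ Y)ᶜ.Nonempty) (hAX : Disjoint A X) (hAY : Disjoint A Y)
    (hXY : Disjoint X Y) (hw : Win f (A ∪ X) Y) : Win f A (X ∪ Y) := by
  by_contra hno
  have hP : IsPart A (X ∪ Y) := ⟨hA, hX.mono Finset.subset_union_left,
    Finset.disjoint_union_right.2 ⟨hAX, hAY⟩, by rwa [← Finset.union_assoc]⟩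
  refine (h.nice4 hA hX hY hC hAX hAY hXY).false_of_merge_left (fun a y c h1 h2 => ?_)
    (fun a x c h1 h2 => ?_)
  · simp only [inst4_eq_left]; exact hw a y c h1 h2
  · simp only [inst4_eq_mid]; exact (h.nice3 hP).on_left_of_not_middleWins hno h1 h2

/-- If a middle group splits into two parts, then one of them wins by itself, the other one having
joined an outer group. -/
lemma win_split (h : NiceN f ρ) (hA : A.Nonempty) (hX : X.Nonempty)
    (hY : Y.Nonempty) (hC : (A ∪ X ∪ Y)ᶜ.Nonempty) (hAX : Disjoint A X) (hAY : Disjoint A Y)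
    (hXY : Disjoint X Y) (hw : Win f A (X ∪ Y)) : Win f (A ∪ X) Y ∨ Win f A X := by
  by_contra! hno
  have hP1 : IsPart (A ∪ X) Y := ⟨hA.mono Finset.subset_union_left, hY,
    Finset.disjoint_union_left.2 ⟨hAY, hXY⟩, hC⟩
  have hP2 : IsPart A X := ⟨hA, hX, hAX, hC.mono (by
    rw [Finset.compl_subset_compl]; exact Finset.subset_union_left)⟩
  refine (h.nice4 hA hX hY hC hAX hAY hXY).false_of_split_middle (fun a y c h1 h2 => ?_)
    (fun a x c h1 h2 => ?_) (fun a x c h1 h2 => ?_)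
  · simp only [inst4_eq_left]
    exact ⟨(h.nice3 hP1).on_left_of_not_middleWins hno.1 h1 h2,
      (h.nice3 hP1).on_right_of_not_middleWins hno.1 h1 h2⟩
  · simp only [inst4_eq_right]
    exact ⟨(h.nice3 hP2).on_left_of_not_middleWins hno.2 h1 h2,
      (h.nice3 hP2).on_right_of_not_middleWins hno.2 h1 h2⟩
  · simp only [inst4_eq_mid]; exact hw a x c h1 h2

/-- Some agents of the left group may change sides without affecting the win of the middle group. -/
lemma win_shrink (h : NiceN f ρ) (hP : IsPart A B) (hX : X.Nonempty) (hXA : X ⊆ A)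
    (hw : Win f A B) : Win f X B := by
  rcases hXA.eq_or_ssubset with rfl | hss
  · exact hw
  obtain ⟨Y, hY⟩ : ∃ Y, Y = A \ X := ⟨_, rfl⟩
  have hYne : Y.Nonempty := by rw [hY]; exact Finset.sdiff_nonempty.2 hss.2
  have hXY : Disjoint X Y := by rw [hY]; exact Finset.disjoint_sdiff
  have hA : A = X ∪ Y := by rw [hY]; exact (Finset.union_sdiff_of_subset hXA).symm
  subst hA
  obtain ⟨hXB, hYB⟩ := Finset.disjoint_union_left.1 hP.disj
  have h1 := h.win_merge_left hX hYne hP.mid hP.right hXY hXB hYB hw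
  rw [Finset.union_comm] at h1
  have hC : (X ∪ B ∪ Y)ᶜ.Nonempty := by rw [Finset.union_right_comm]; exact hP.right
  refine (h.win_split hX hP.mid hYne hC hXB hXY hYB.symm h1).resolve_left fun h2 => ?_
  rw [Finset.union_comm] at h2
  have h3 := h.win_merge_left hP.mid hX hYne (by rwa [Finset.union_comm B X]) hXB.symm
    hYB.symm hXY h2
  exact h.not_win_swap_left hP hw h3

lemma win_enlarge (h : NiceN f ρ) (hP : IsPart A B) (hX : IsPart X B) (hAX : A ⊆ X)
    (hw : Win f A B) : Win f X B := by
  have := h.reflN.win_shrink hP.rev hX.right (by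
    rw [Finset.compl_subset_compl]; exact Finset.union_subset_union_left hAX)
    ((win_reflN hP.disj).2 hw)
  exact (win_reflN hX.disj).1 this

/-- If a single agent `j` wins in the middle for some partition of the other agents, then she wins
for all of them. -/
lemma win_singleton (h : NiceN f ρ) (hn : 4 ≤ n) {j : Fin n} (hA : IsPart A {j})
    (hX : IsPart X {j}) (hw : Win f A {j}) : Win f X {j} := by
  have part : ∀ Z : Finset (Fin n), Z.Nonempty → j ∉ Z → (∃ k, k ≠ j ∧ k ∉ Z) →
      IsPart Z {j} := by
    intro Z h1 h2 ⟨k, h3, h4⟩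
    exact ⟨h1, by simp, by simpa using h2, k, by simp [h3, h4]⟩
  have hjA : j ∉ A := by simpa using hA.disj
  have hjX : j ∉ X := by simpa using hX.disj
  -- from `U` to `V`, if these overlap, or if they do not exhaust the agents other than `j`
  have meet : ∀ U V : Finset (Fin n), IsPart U {j} → IsPart V {j} → (U ∩ V).Nonempty →
      Win f U {j} → Win f V {j} := by
    intro U V hU hV hne hWU
    have hjU : j ∉ U := by simpa using hU.disj
    obtain ⟨k, hk⟩ := hU.right
    have hUV : IsPart (U ∩ V) {j} := part _ hne (by simp [hjU]) ⟨k, by simp_all⟩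
    exact h.win_enlarge hUV hV Finset.inter_subset_right
      (h.win_shrink hU hne Finset.inter_subset_left hWU)
  have join : ∀ U V : Finset (Fin n), IsPart U {j} → IsPart V {j} →
      (∃ k, k ≠ j ∧ k ∉ U ∧ k ∉ V) → Win f U {j} → Win f V {j} := by
    rintro U V hU hV ⟨k, h1, h2, h3⟩ hWU
    have hjU : j ∉ U := by simpa using hU.disj
    have hjV : j ∉ V := by simpa using hV.disj
    have hUV : IsPart (U ∪ V) {j} := part _ (hU.left.mono Finset.subset_union_left)
      (by simp [hjU, hjV]) ⟨k, by simp_all⟩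
    exact h.win_shrink hUV hV.left Finset.subset_union_right
      (h.win_enlarge hU hUV Finset.subset_union_left hWU)
  by_cases hd : (A ∩ X).Nonempty
  · exact meet A X hA hX hd hw
  by_cases hk : ∃ k, k ≠ j ∧ k ∉ A ∧ k ∉ X
  · exact join A X hA hX hk hw
  push Not at hk
  have hAX : ∀ i ∈ A, i ∉ X := fun i h1 h2 => hd ⟨i, by simp [h1, h2]⟩
  obtain ⟨p, hp⟩ := hA.left
  obtain ⟨q, hq⟩ := hX.left
  -- a third agent besides `j`, in one of the two sets
  obtain ⟨m, hm⟩ : ∃ m, m ∉ ({j, p, q} : Finset (Fin n)) := by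
    by_contra! hall
    have h1 : Finset.univ ⊆ ({j, p, q} : Finset (Fin n)) := fun i _ => hall i
    have h2 := (Finset.card_le_card h1).trans Finset.card_le_three
    simp only [Finset.card_univ, Fintype.card_fin] at h2
    omega
  simp only [Finset.mem_insert, Finset.mem_singleton, not_or] at hm
  by_cases hmA : m ∈ A
  · have hpP : IsPart {p} {j} := part _ (by simp) (by grind) ⟨m, by grind⟩
    exact join {p} X hpP hX ⟨m, hm.1, by simp [hm.2.1], hAX m hmA⟩
      (h.win_shrink hA (by simp) (by simpa using hp) hw)
  · have hmX : m ∈ X := by by_contra hmX; exact hmX (hk m hm.1 hmA)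
    have hmP : IsPart {m} {j} := part _ (by simp) (by grind) ⟨p, by grind⟩
    exact meet {m} X hmP hX ⟨m, by simp [hmX]⟩
      (join A {m} hA hmP ⟨q, by grind⟩ hw)

lemma exists_win_singleton (h : NiceN f ρ) : ∀ (m : ℕ) (A B : Finset (Fin n)), B.card = m →
    IsPart A B → Win f A B → ∃ X j, IsPart X {j} ∧ Win f X {j} := by
  intro m
  induction m with
  | zero => intro A B h1 hP; simp_all [hP.mid.ne_empty]
  | succ m ih =>
    intro A B hm hP hw
    obtain ⟨j, hj⟩ := hP.mid
    by_cases hB : (B.erase j).Nonempty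
    · have hBe : B = {j} ∪ B.erase j := by
        rw [← Finset.insert_eq, Finset.insert_erase hj]
      have hAj : Disjoint A {j} := hP.disj.mono_right (by simpa using hj)
      have hAe : Disjoint A (B.erase j) := hP.disj.mono_right (Finset.erase_subset _ _)
      have hje : Disjoint {j} (B.erase j) := by simp
      have hC : (A ∪ {j} ∪ B.erase j)ᶜ.Nonempty := by
        rw [Finset.union_assoc, ← hBe]; exact hP.right
      rcases h.win_split hP.left (Finset.singleton_nonempty j) hB hC hAj hAe hje
        (by rwa [← hBe]) with h1 | h1
      · exact ih _ _ (by rw [Finset.card_erase_of_mem hj, hm]; rfl)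
          ⟨hP.left.mono Finset.subset_union_left, hB,
            Finset.disjoint_union_left.2 ⟨hAe, hje⟩, hC⟩ h1
      · exact ⟨A, j, ⟨hP.left, by simp, hAj, hC.mono (by
          rw [Finset.compl_subset_compl]; exact Finset.subset_union_left)⟩, h1⟩
    · have : B = {j} := by
        rw [Finset.not_nonempty_iff_eq_empty, Finset.erase_eq_empty_iff] at hB
        rcases hB with hB | hB
        · simp [hB] at hj
        · exact hB
      subst this
      exact ⟨A, j, hP, hw⟩

end NiceN

/-! ### Extremes and dictators -/

/-- Two agents and all the others form a partition into three groups. -/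
lemma isPart_singleton (hn : 3 ≤ n) {j k : Fin n} (hjk : j ≠ k) :
    IsPart {j} ({k} : Finset (Fin n)) := by
  refine ⟨by simp, by simp, by simpa using hjk, ?_⟩
  rw [← Finset.card_pos, Finset.card_compl, Fintype.card_fin]
  have h1 : ({j} ∪ {k} : Finset (Fin n)).card ≤ 2 := Finset.card_le_two (a := j) (b := k)
  omega

namespace NiceN

variable {f : (Fin n → ℝ) → ℝ × ℝ} {ρ : ℝ}

lemma sp1_update (h : NiceN f ρ) (x : Fin n → ℝ) (j : Fin n) :
    SP1 (fun t => f (Function.update x j t)) :=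
  h.sp1_of_group {j} _ (fun t i hi => by
    rw [Finset.mem_singleton] at hi; subst hi; simp) (fun t t' i hi => by
    rw [Finset.mem_singleton] at hi; simp [Function.update_of_ne hi])

/-- If any set of agents moves to a facility location, the facility stays there. -/
lemma on_of_move (h : NiceN f ρ) {x : Fin n → ℝ} {u : ℝ} (hu : On (f x) u)
    (S : Finset (Fin n)) : On (f (fun i => if i ∈ S then u else x i)) u := by
  classical
  induction S using Finset.induction_on with
  | empty => simpa using hu
  | insert i S hi ih =>
    have h1 := (h.sp1_update (fun i => if i ∈ S then u else x i) i).fix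
      (z := if i ∈ S then u else x i) (t := u) (by simpa using ih)
    convert h1 using 2
    ext k
    by_cases hk : k = i
    · subst hk; simp
    · simp [hk]

/-- Instances with at most two distinct locations are solved exactly. -/
lemma on_of_two_locations (h : NiceN f ρ) {x : Fin n → ℝ} (z : ℝ × ℝ) (hx : ∀ i, On z (x i))
    (i : Fin n) : On (f x) (x i) := by
  have h1 := h.bound x i z
  have h2 : socialCost x z = 0 := Finset.sum_eq_zero fun k _ => agentCost_eq_zero (hx k)
  rw [h2, mul_zero] at h1
  exact on_of_agentCost_le_zero h1

/-- If no middle group ever wins, then no facility is strictly between two agents. -/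
lemma not_on_between (h : NiceN f ρ) (hn : 3 ≤ n) (hw : ∀ A B, IsPart A B → ¬ Win f A B)
    {x : Fin n → ℝ} {u : ℝ} {i k : Fin n} (hi : x i < u) (hk : u < x k) : ¬ On (f x) u := by
  intro hu
  have hik : i ≠ k := fun he => by subst he; exact lt_asymm hi hk
  have hP : IsPart {i} ({i, k}ᶜ : Finset (Fin n)) := by
    refine ⟨by simp, ?_, by simp, k, by simp [hik.symm]⟩
    rw [← Finset.card_pos, Finset.card_compl, Fintype.card_fin]
    have := Finset.card_le_two (a := i) (b := k)
    omega
  refine hw _ _ hP ((h.nice3 hP).middleWins_of_on hi hk ?_)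
  have h1 := h.on_of_move hu {i, k}ᶜ
  convert h1 using 2
  ext m
  simp only [inst3, Finset.mem_compl, Finset.mem_insert, Finset.mem_singleton]
  grind

/-- If no middle group ever wins, then the leftmost agents get a facility. Otherwise there is a gap
of the locations available to them; if they moved almost to its right end, a facility would appear
strictly between two agents. -/
lemma on_min (h : NiceN f ρ) (hn : 3 ≤ n) (hw : ∀ A B, IsPart A B → ¬ Win f A B) :
    ∀ (m : ℕ) (x : Fin n → ℝ) (i : Fin n), (∀ k, x i ≤ x k) →
      (Finset.univ.filter fun k => x k ≠ x i).card = m → On (f x) (x i) := by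
  intro m
  induction m using Nat.strong_induction_on with
  | _ m ih =>
    intro x i hi hm
    by_contra hno
    have hne : (Finset.univ.filter fun k => x k ≠ x i).Nonempty := by
      by_contra hemp
      rw [Finset.not_nonempty_iff_eq_empty, Finset.filter_eq_empty_iff] at hemp
      push Not at hemp
      exact hno (h.on_of_two_locations (x i, x i) (fun k => Or.inl (hemp (Finset.mem_univ k)).symm) i)
    -- the second smallest location, and a location beyond it
    obtain ⟨p, hp, hpmin⟩ := Finset.exists_min_image _ x hne
    simp only [Finset.mem_filter, Finset.mem_univ, true_and] at hp hpmin
    have hip : x i < x p := lt_of_le_of_ne (hi p) (Ne.symm hp)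
    obtain ⟨q, hq⟩ : ∃ q, x p < x q := by
      by_contra! hall
      refine hno (h.on_of_two_locations (x i, x p) (fun k => ?_) i)
      by_cases hk : x k = x i
      · exact Or.inl hk.symm
      · exact Or.inr (le_antisymm (hpmin k hk) (hall k))
    set y : ℝ → Fin n → ℝ := fun t k => if x k = x i then t else x k with hy
    have hsp : SP1 (fun t => f (y t)) := h.sp1_of_group (Finset.univ.filter fun k => x k = x i) y
      (fun t k hk => by simp_all) (fun t t' k hk => by simp_all)
    have hyx : y (x i) = x := by
      ext k; simp only [hy]; split_ifs with hk
      · exact hk.symm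
      · rfl
    have hyp : On (f (y (x p))) (x p) := by
      have hpp : y (x p) p = x p := by simp [hy]
      have h1 := ih _ ?_ (y (x p)) p (fun k => ?_) rfl
      · rwa [hpp] at h1
      · rw [← hm]
        refine Finset.card_lt_card ⟨fun k hk => ?_, fun hsub => ?_⟩
        · simp only [hpp, Finset.mem_filter, Finset.mem_univ, true_and] at hk ⊢
          intro hki
          exact hk (by simp [hy, hki])
        · have := @hsub p (by simp [hp])
          simp [hpp] at this
      · rw [hpp]
        simp only [hy]
        split_ifs with hk
        · exact le_rfl
        · exact hpmin k hk
    obtain ⟨r, hr1, hr2, -, -, hr⟩ := hsp.exists_right (a := x i) (by rwa [hyx]) hyp hip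
    refine h.not_on_between hn hw (x := y ((x i + 3 * r) / 4)) (u := r) (i := i) (k := q) ?_ ?_
      (hr _ (by linarith) (by linarith))
    · simp only [hy, if_true]; linarith
    · have : x q ≠ x i := (hip.trans hq).ne'
      simp only [hy, if_neg this]; linarith

/-- If an agent `j` who wins in the middle against any other single agent on her left gets no
facility, then all others are strictly to the right of her. -/
lemma lt_of_not_on (h : NiceN f ρ) (hn : 3 ≤ n) {j : Fin n} (hj : ∀ k, k ≠ j → Win f {k} {j})
    {x : Fin n → ℝ} (hx : ¬ On (f x) (x j)) {k : Fin n} (hk : k ≠ j) : x j < x k := by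
  have hρ := h.one_le
  have hsp := h.sp1_update x j
  -- far away locations on the right are available to the agent
  set C := ∑ i, |x i| with hC
  have hC0 : 0 ≤ C := Finset.sum_nonneg fun i _ => abs_nonneg _
  set T := |x j| + 1 + ρ * C with hT
  obtain ⟨s, hs, hs'⟩ := exists_nearest T (f (Function.update x j T))
  have h1 := h.bound (Function.update x j T) j (T, 0)
  have h2 : socialCost (Function.update x j T) (T, 0) ≤ C := by
    refine Finset.sum_le_sum fun i _ => ?_
    by_cases hi : i = j
    · subst hi
      rw [Function.update_self, agentCost_eq_zero (show On (T, 0) T from Or.inl rfl)]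
      exact abs_nonneg _
    · rw [Function.update_of_ne hi]
      simpa using On.agentCost_le (y := (T, 0)) (Or.inr rfl) (x i)
  rw [Function.update_self, hs'] at h1
  have h3 : x j < s := by
    have := (abs_le.1 (h1.trans (mul_le_mul_of_nonneg_left h2 (by linarith)))).2
    linarith [le_abs_self (x j)]
  obtain ⟨r, hr1, hr2, -, -, hr⟩ := hsp.exists_right (a := x j) (by simpa using hx)
    (hsp.fix hs) h3
  by_contra hkj
  push Not at hkj
  have hP := isPart_singleton hn hk
  have hN := h.nice3 hP
  have hρn := hN.one_le
  -- With `j` close to `r` and all others except `k` at `r`, facilities are at `j` and at `r`.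
  set ε := (r - x j) / (2 * (ρ * n + 1)) with hε
  have hε0 : 0 < ε := by apply div_pos <;> linarith
  have hε' : (ρ * n + 1) * ε = (r - x j) / 2 := by rw [hε]; field_simp
  have hε1 : 2 * ε ≤ (r - x j) / 2 := by nlinarith
  have h5 : On (f (inst3 {k} {j} (x k) (r - ε) r)) r := by
    have h6 := h.on_of_move (hr (r - ε) (by linarith) (by linarith)) {k, j}ᶜ
    convert h6 using 2
    ext m
    simp only [inst3, Finset.mem_compl, Finset.mem_insert, Finset.mem_singleton]
    by_cases hm : m = j
    · subst hm; simp [Ne.symm hk]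
    · rw [Function.update_of_ne hm]
      grind
  have h6 := hj k hk (x k) (r - ε) r (by linarith) (by linarith)
  obtain ⟨w, hw, hw'⟩ := exists_nearest (x k) (f (inst3 {k} {j} (x k) (r - ε) r))
  have h7 := hN.cost_le_right (x k) (r - ε) r (t := x k) (by tauto)
  rw [hw', abs_sub_comm (r - ε), sub_sub_cancel, abs_of_pos hε0] at h7
  have h8 := neg_abs_le (x k - w)
  rcases hw.eq_or h6 h5 (by linarith) with hh | hh <;> nlinarith

end NiceN

lemma Mechanism.Nice.exists_niceN {F : Mechanism n} (hF : F.Nice) :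
    ∃ ρ, NiceN F.place ρ := by
  obtain ⟨hsp, ρ, hρ, happ⟩ := hF
  refine ⟨ρ, hρ, hsp, fun x i z => ?_⟩
  have h0 : ∀ w, 0 ≤ socialCost x w := fun w => Finset.sum_nonneg fun _ _ => agentCost_nonneg _ _
  calc agentCost (x i) (F.place x) ≤ socialCost x (F.place x) :=
        Finset.single_le_sum (f := fun i => agentCost (x i) (F.place x))
          (fun _ _ => agentCost_nonneg _ _) (Finset.mem_univ i)
    _ ≤ ρ * optCost x := happ x
    _ ≤ ρ * socialCost x z := by
        gcongr
        exact ciInf_le ⟨0, by rintro _ ⟨w, rfl⟩; exact h0 w⟩ z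

lemma NiceN.alwaysAtExtremes {F : Mechanism n} {ρ : ℝ} (h : NiceN F.place ρ) (hn : 3 ≤ n)
    (hw : ∀ A B, IsPart A B → ¬ Win F.place A B) : F.AlwaysAtExtremes := by
  have : Nonempty (Fin n) := ⟨⟨0, by omega⟩⟩
  have hw' : ∀ A B, IsPart A B → ¬ Win (FacilityLocation.reflN F.place) A B := by
    intro A B hP hwin
    have h1 := win_reflN (f := F.place) hP.rev.disj
    rw [compl_compl_union hP.disj] at h1
    exact hw _ _ hP.rev (h1.1 hwin)
  refine ⟨fun x ⟨i, k, hik⟩ => ?_, fun c => ?_⟩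
  · obtain ⟨p, hp⟩ := Finite.exists_min x
    obtain ⟨q, hq⟩ := Finite.exists_max x
    have hmin : minLoc x = x p :=
      le_antisymm (ciInf_le ⟨x p, by rintro _ ⟨m, rfl⟩; exact hp m⟩ p) (le_ciInf hp)
    have hmax : maxLoc x = x q :=
      le_antisymm (ciSup_le hq) (le_ciSup (f := x) ⟨x q, by rintro _ ⟨m, rfl⟩; exact hq m⟩ q)
    have hpq : x p < x q := by
      rcases lt_or_gt_of_ne hik with h1 | h1
      · exact (hp i).trans_lt (h1.trans_le (hq k))
      · exact (hp k).trans_lt (h1.trans_le (hq i))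
    have h1 : On (F.place x) (x p) := h.on_min hn hw _ x p hp rfl
    have h2 : On (F.place x) (x q) := by
      have := h.reflN.on_min hn hw' _ (-x) q (fun k => by simpa using hq k) rfl
      simpa only [FacilityLocation.reflN, on_negOutcome, Pi.neg_apply, neg_neg] using this
    have h3 := F.ordered x
    rw [hmin, hmax]
    rcases h1 with h1 | h1
    · rcases h2 with h2 | h2
      · linarith
      · exact Prod.ext h1 h2
    · rcases h2 with h2 | h2 <;> linarith
  · exact h.on_of_two_locations (x := fun _ => c) (c, c) (fun _ => Or.inl rfl) (Classical.arbitrary _)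

lemma NiceN.isDictator {F : Mechanism n} {ρ : ℝ} (h : NiceN F.place ρ) (hn : 3 ≤ n) {j : Fin n}
    (hj : ∀ A, IsPart A {j} → Win F.place A {j}) : F.IsDictator j := by
  intro x
  by_contra hx
  have hP := fun (k : Fin n) (hk : k ≠ j) => isPart_singleton hn hk
  obtain ⟨k, hk⟩ : ∃ k, k ≠ j := by
    have : Nontrivial (Fin n) := Fin.nontrivial_iff_two_le.2 (by omega)
    exact exists_ne j
  have h1 := h.lt_of_not_on hn (fun k hk => hj _ (hP k hk)) hx hk
  have h2 := h.reflN.lt_of_not_on (j := j) hn (fun k hk => ?_) (x := -x) ?_ hk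
  · simp only [Pi.neg_apply] at h2
    linarith
  · have h3 := win_reflN (f := F.place) (hP k hk).rev.disj
    rw [compl_compl_union (hP k hk).disj] at h3
    exact h3.2 (hj _ (hP k hk).rev)
  · rw [FacilityLocation.reflN, on_negOutcome, neg_neg, Pi.neg_apply, neg_neg]
    exact hx

/-- Two dictators at distinct but close locations would leave a third agent far away from all
facilities. -/
lemma NiceN.dictator_unique {F : Mechanism n} {ρ : ℝ} (h : NiceN F.place ρ) (hn : 3 ≤ n)
    {j k : Fin n} (hj : F.IsDictator j) (hk : F.IsDictator k) : k = j := by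
  by_contra hkj
  have hP := isPart_singleton hn (Ne.symm hkj)
  have hN := h.nice3 hP
  have hρn := hN.one_le
  have hε0 : 0 < 1 / (2 * (ρ * n + 1)) := by positivity
  have hε' : (ρ * n + 1) * (1 / (2 * (ρ * n + 1))) = 1 / 2 := by field_simp
  set ε := 1 / (2 * (ρ * n + 1))
  have h1 : On (F.place (inst3 {j} {k} 0 ε 1)) 0 := by
    have h0 : On _ _ := hj (inst3 {j} {k} 0 ε 1)
    simpa [inst3] using h0
  have h2 : On (F.place (inst3 {j} {k} 0 ε 1)) ε := by
    have h0 : On _ _ := hk (inst3 {j} {k} 0 ε 1)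
    simpa [inst3, hkj] using h0
  obtain ⟨w, hw, hw'⟩ := exists_nearest 1 (F.place (inst3 {j} {k} 0 ε 1))
  have h7 := hN.cost_le_left 0 ε 1 (t := 1) (by tauto)
  rw [hw', zero_sub, abs_neg, abs_of_pos hε0] at h7
  have h8 := le_abs_self (1 - w)
  rcases hw.eq_or h1 h2 hε0.ne with hh | hh <;> nlinarith

end FacilityLocation

theorem theorem1 (n : ℕ) (hn : 5 ≤ n) (F : FacilityLocation.Mechanism n) (hF : F.Nice) :
    F.AlwaysAtExtremes ∨ ∃! j : Fin n, F.IsDictator j := by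
  obtain ⟨ρ, h⟩ := hF.exists_niceN
  by_cases hw : ∀ A B, FacilityLocation.IsPart A B → ¬ FacilityLocation.Win F.place A B
  · exact Or.inl (h.alwaysAtExtremes (by omega) hw)
  · right
    push Not at hw
    obtain ⟨A, B, hP, hwin⟩ := hw
    obtain ⟨X, j, hX, hXwin⟩ := h.exists_win_singleton _ A B rfl hP hwin
    exact ⟨j, h.isDictator (by omega) fun Z hZ => h.win_singleton (by omega) hX hZ hXwin,
      fun k hk => h.dictator_unique (by omega)
        (h.isDictator (by omega) fun Z hZ => h.win_singleton (by omega) hX hZ hXwin) hk⟩
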